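/- Let $A_1,\dots,A_d\in\mathbb R^{m\times n}$, let $\mathcal A:\mathbb R^{m\times n}\to\mathbb R^d$, $\mathcal A X=(\langle A_i,X\rangle)_{i=1}^d$, with adjoint $\mathcal A^*z=\sum_i z_iA_i$, let $f:\mathbb R^d\to\mathbb R$ be convex and continuously differentiable, let $\alpha\ge 0$, and consider the problem $$\text{minimize } f(\mathcal A X)\quad\text{subject to}\quad \|X\|_{S_1}\le\alpha ,\qquad X\in\mathbb R^{m\times n},$$ where $\|\cdot\|_{S_1}$ is the sum of the singular values. Its curvature constant is $$C=\sup\Big\{\tfrac{2}{\gamma^2}\big(f(\mathcal A Y)-f(\mathcal A X)-\langle Y-X,\mathcal A^*\nabla f(\mathcal A X)\rangle\big):\ \|X\|_{S_1},\|S\|_{S_1}\le\alpha,\ 0<\gamma\le1,\ Y=X+\gamma(S-X)\Big\}\in[0,\infty].$$ Fix an integer $r\ge 0$ and put $k=2r+1$, $\ell=4r+3$. SketchyCGM draws independent standard normal matrices $\Omega\in\mathbb R^{n\times k}$ and $\Psi\in\mathbb R^{\ell\times m}$, starts from $z_0=0\in\mathbb R^d$, $Y_0=0\in\mathbb R^{m\times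 k}$, $W_0=0\in\mathbb R^{\ell\times n}$, and for $t=0,1,2,\dots$ takes a pair $(u_t,v_t)$ of unit left/right maximum singular vectors of $\mathcal A^*(\nabla f(z_t))$ (chosen independently of the random draw), sets $H_t=-\alpha u_tv_t^*$, $\eta_t=2/(t+2)$ and $$z_{t+1}=(1-\eta_t)z_t+\eta_t\mathcal A H_t,\qquad Y_{t+1}=(1-\eta_t)Y_t+\eta_tH_t\Omega,\qquad W_{t+1}=(1-\eta_t)W_t+\eta_t\Psi H_t .$$ The rank-$r$ estimate at time $t$ is $\hat X_t=Q[(\Psi Q)^\dagger W_t]_r$, where the columns of $Q$ form an orthonormal basis of the range of $Y_t$, $\dagger$ is the pseudoinverse, and $[M]_r$ is a best rank-$r$ approximation of $M$ in Frobenius norm (with the choices of $Q$ and of $[\cdot]_r$ made so that $\hat X_t$ is a random matrix, that is, measurable). Let $\kappa>0$ and $\nu>0$. Suppose that the (unique) solution $X_\star$ of the problem has $\operatorname{rank}(X_\star)\le r$ and that $$f(\mathcal A X)-f(\mathcal A X_\star)\ \ge\ \kappa\,\|X-X_\star\|_F^{\nu}\qquad\text{for all } X \text{ with } \|X\|_{S_1}\le\alpha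 .$$ Then, for every $t=1,2,3,\dots$, the expectation below is finite and $$\mathbb E\,\|\hat X_t-X_\star\|_F\ \le\ 6\left(\frac{2C\kappa^{-1}}{t+2}\right)^{1/\nu}.$$ -/

import Mathlib

open MeasureTheory ProbabilityTheory
open scoped ENNReal Matrix Matrix.Norms.Frobenius

namespace SketchyCGM

noncomputable section

/-- The linear map `X ↦ (⟨A₁, X⟩, …, ⟨A_d, X⟩)`, with the trace (Frobenius) inner product. -/
def linMap {m n d : ℕ} (A : Fin d → Matrix (Fin m) (Fin n) ℝ) (X : Matrix (Fin m) (Fin n) ℝ) :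
    EuclideanSpace ℝ (Fin d) :=
  WithLp.toLp 2 (fun i => ((A i)ᵀ * X).trace)

/-- The adjoint `z ↦ ∑ i, z_i A_i` of `linMap A`. -/
def linMapAdj {m n d : ℕ} (A : Fin d → Matrix (Fin m) (Fin n) ℝ)
    (z : EuclideanSpace ℝ (Fin d)) : Matrix (Fin m) (Fin n) ℝ :=
  ∑ i, z i • A i

/-- The Schatten 1-norm: the sum of the singular values. -/
def schattenOneNorm {m n : ℕ} (X : Matrix (Fin m) (Fin n) ℝ) : ℝ :=
  (Matrix.toEuclideanLin X).singularValues.sum (fun _ s => s)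

/-- `X` is feasible for the problem: minimize `f (𝒜 X)` subject to `‖X‖_{S₁} ≤ α`. -/
def Feasible {m n : ℕ} (α : ℝ) (X : Matrix (Fin m) (Fin n) ℝ) : Prop :=
  schattenOneNorm X ≤ α

/-- `X` solves the problem: minimize `f (𝒜 X)` subject to `‖X‖_{S₁} ≤ α`. -/
def IsSolution {m n d : ℕ} (α : ℝ) (A : Fin d → Matrix (Fin m) (Fin n) ℝ)
    (f : EuclideanSpace ℝ (Fin d) → ℝ) (X : Matrix (Fin m) (Fin n) ℝ) : Prop :=
  Feasible α X ∧ ∀ Z, Feasible α Z → f (linMap A X) ≤ f (linMap A Z)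

/-- The gradient of `X ↦ f (𝒜 X)`, namely `𝒜* (∇f (𝒜 X))`. -/
def objGrad {m n d : ℕ} (A : Fin d → Matrix (Fin m) (Fin n) ℝ)
    (f : EuclideanSpace ℝ (Fin d) → ℝ) (X : Matrix (Fin m) (Fin n) ℝ) :
    Matrix (Fin m) (Fin n) ℝ :=
  linMapAdj A (gradient f (linMap A X))

/-- The curvature constant of the problem: the supremum of
`2 / γ² * (g Y - g X - ⟨Y - X, ∇g X⟩)` over feasible `X`, `S` and `0 < γ ≤ 1`, where
`Y = X + γ (S - X)` and `g = f ∘ 𝒜`. For convex `f` each of these numbers is nonnegative;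
the supremum may be infinite. -/
def curvature {m n d : ℕ} (α : ℝ) (A : Fin d → Matrix (Fin m) (Fin n) ℝ)
    (f : EuclideanSpace ℝ (Fin d) → ℝ) : ℝ≥0∞ :=
  ⨆ (X : Matrix (Fin m) (Fin n) ℝ) (_ : Feasible α X)
    (S : Matrix (Fin m) (Fin n) ℝ) (_ : Feasible α S) (γ : ℝ) (_ : 0 < γ ∧ γ ≤ 1),
    ENNReal.ofReal (2 / γ ^ 2 *
      (f (linMap A (X + γ • (S - X))) - f (linMap A X)
        - (((X + γ • (S - X)) - X)ᵀ * objGrad A f X).trace))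

/-- `(u, v)` is a left/right pair of (unit) maximum singular vectors of `G`. -/
def IsMaxSingVec {m n : ℕ} (G : Matrix (Fin m) (Fin n) ℝ) (u : Fin m → ℝ) (v : Fin n → ℝ) :
    Prop :=
  u ⬝ᵥ u = 1 ∧ v ⬝ᵥ v = 1 ∧
    G *ᵥ v = (Matrix.toEuclideanLin G).singularValues 0 • u ∧
    Gᵀ *ᵥ u = (Matrix.toEuclideanLin G).singularValues 0 • v

/-- The learning rate `η_t = 2 / (t + 2)`. -/
def stepSize (t : ℕ) : ℝ := 2 / ((t : ℝ) + 2)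

/-- The rank-one update direction `H_t = -α u_t v_tᵀ`. -/
def updateDir {m n : ℕ} (α : ℝ) (u : ℕ → Fin m → ℝ) (v : ℕ → Fin n → ℝ) (t : ℕ) :
    Matrix (Fin m) (Fin n) ℝ :=
  -(α • Matrix.vecMulVec (u t) (v t))

/-- The dual iterates: `z_0 = 0`, `z_{t+1} = (1 - η_t) z_t + η_t 𝒜 (-α u_t v_tᵀ)`. -/
def dualIterate {m n d : ℕ} (α : ℝ) (A : Fin d → Matrix (Fin m) (Fin n) ℝ)
    (u : ℕ → Fin m → ℝ) (v : ℕ → Fin n → ℝ) : ℕ → EuclideanSpace ℝ (Fin d)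
  | 0 => 0
  | t + 1 => (1 - stepSize t) • dualIterate α A u v t
      + stepSize t • linMap A (updateDir α u v t)

/-- The range sketches: `Y_0 = 0`, `Y_{t+1} = (1 - η_t) Y_t + η_t (-α u_t v_tᵀ) Ω`. -/
def rangeSketch {m n k : ℕ} (α : ℝ) (u : ℕ → Fin m → ℝ) (v : ℕ → Fin n → ℝ)
    (Om : Matrix (Fin n) (Fin k) ℝ) : ℕ → Matrix (Fin m) (Fin k) ℝ
  | 0 => 0
  | t + 1 => (1 - stepSize t) • rangeSketch α u v Om t
      + stepSize t • (updateDir α u v t * Om)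

/-- The co-range sketches: `W_0 = 0`, `W_{t+1} = (1 - η_t) W_t + η_t Ψ (-α u_t v_tᵀ)`. -/
def corangeSketch {m n l : ℕ} (α : ℝ) (u : ℕ → Fin m → ℝ) (v : ℕ → Fin n → ℝ)
    (Psi : Matrix (Fin l) (Fin m) ℝ) : ℕ → Matrix (Fin l) (Fin n) ℝ
  | 0 => 0
  | t + 1 => (1 - stepSize t) • corangeSketch α u v Psi t
      + stepSize t • (Psi * updateDir α u v t)

/-- `N` is the Moore–Penrose pseudoinverse of the real matrix `M` (the four Penrose equations). -/
def IsPseudoinverse {a b : ℕ} (M : Matrix (Fin a) (Fin b) ℝ) (N : Matrix (Fin b) (Fin a) ℝ) :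
    Prop :=
  M * N * M = M ∧ N * M * N = N ∧ (M * N)ᵀ = M * N ∧ (N * M)ᵀ = N * M

/-- `B'` is a best rank-`r` approximation of `B` in Frobenius norm. -/
def IsBestRankApprox {a b : ℕ} (r : ℕ) (B B' : Matrix (Fin a) (Fin b) ℝ) : Prop :=
  B'.rank ≤ r ∧ ∀ Z : Matrix (Fin a) (Fin b) ℝ, Z.rank ≤ r → ‖B - B'‖ ≤ ‖B - Z‖

/-- `Xhat` is a result of the rank-`r` reconstruction procedure from the sketch `(Y, W)`:
`Q = orth Y`, `B = (Ψ Q)† W`, `Xhat = Q [B]_r`. -/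
def IsReconstruction {m n k l : ℕ} (r : ℕ) (Psi : Matrix (Fin l) (Fin m) ℝ)
    (Y : Matrix (Fin m) (Fin k) ℝ) (W : Matrix (Fin l) (Fin n) ℝ)
    (Xhat : Matrix (Fin m) (Fin n) ℝ) : Prop :=
  ∃ (q : ℕ) (Q : Matrix (Fin m) (Fin q) ℝ) (N : Matrix (Fin q) (Fin l) ℝ)
    (B' : Matrix (Fin q) (Fin n) ℝ),
    Qᵀ * Q = 1 ∧ LinearMap.range Q.mulVecLin = LinearMap.range Y.mulVecLin ∧
    IsPseudoinverse (Psi * Q) N ∧ IsBestRankApprox r (N * W) B' ∧ Xhat = Q * B'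

/-- The random matrices `Om` and `Psi` are independent standard normal matrices:
all their entries together are independent standard normal random variables. -/
def IndepStdNormal {Ω : Type*} [MeasurableSpace Ω] (P : Measure Ω) {m n k l : ℕ}
    (Om : Ω → Matrix (Fin n) (Fin k) ℝ) (Psi : Ω → Matrix (Fin l) (Fin m) ℝ) : Prop :=
  (∀ i j, HasLaw (fun ω => Om ω i j) (gaussianReal 0 1) P) ∧
  (∀ i j, HasLaw (fun ω => Psi ω i j) (gaussianReal 0 1) P) ∧
  iIndepFun (Sum.elim (fun (p : Fin n × Fin k) (ω : Ω) => Om ω p.1 p.2)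
    (fun (p : Fin l × Fin m) (ω : Ω) => Psi ω p.1 p.2)) P

end

end SketchyCGM

/-! The method never forms its matrix iterate `X_t`, but all it stores is linear in it: `z_t = 𝒜
X_t`, `Y_t = X_t Ω`, `W_t = Ψ X_t`. The singular vectors do not depend on the draw, so `X_t` is
deterministic, and the claim splits into a rate for `X_t` and an error bound for sketching one fixed
matrix.

Rate. The curvature inequality, the optimality of `H_t` for the linearized objective (duality of the
spectral and Schatten 1-norms) and convexity give the Frank–Wolfe bound `2C/(t+2)` on the objective
gap (`objective_primalIterate_sub_le`). The growth condition turns it into a bound on `τ = ‖X_t -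
X⋆‖`.

Sketch. Write `X` for `X_t`, let `P = QQᵀ` project orthogonally onto the range of `XΩ`, and let `T =
Q(ΨQ)†Ψ`. By Pythagoras, `‖X - TX‖²` is `‖(1-P)X‖²` plus `‖(ΨQ)†Ψ(1-P)X‖²`. Given `Ω`, the matrices
`ΨQ` and `Ψ(1-P)` are independent, and the squared Frobenius norm of `(ΨQ)†` has expectation at most
`q/(ℓ-q-1) ≤ 1`, because `ℓ ≥ 2q+1`. So the second term is on average no larger than the first. The
same argument (`ae_isUnit_det_compression`), applied to `Ω` and the row space of `X⋆`, gives
`E‖(1-P)X‖² ≤ 2τ²`, because `k = 2r+1`. Altogether `E‖X - TX‖² ≤ 4τ²`; by Jensen `TX` is on average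
within `2τ + τ` of `X⋆`, and truncation to rank `r ≥ rank X⋆` at most doubles this, whence `6τ`.

The basis `Q` need not depend measurably on the draw, so the error is expressed through `P`, which
is unique and measurable (`rangeProj`, `obliqueProj`). -/

namespace SketchyCGM

/-! ### Singular values and duality for the Schatten 1-norm -/

/-- The images of the eigenvectors of `T* T` are orthogonal, and their norms are the singular
values of `T`. -/
lemma exists_singularBasis {n : ℕ} {F : Type*} [NormedAddCommGroup F] [InnerProductSpace ℝ F]
    [FiniteDimensional ℝ F] (T : EuclideanSpace ℝ (Fin n) →ₗ[ℝ] F) :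
    ∃ b : OrthonormalBasis (Fin n) ℝ (EuclideanSpace ℝ (Fin n)),
      ∀ i j, inner ℝ (T (b i)) (T (b j)) = if i = j then T.singularValues i ^ 2 else 0 := by
  have hn : Module.finrank ℝ (EuclideanSpace ℝ (Fin n)) = n := finrank_euclideanSpace_fin
  refine ⟨T.isSymmetric_adjoint_comp_self.eigenvectorBasis hn, fun i j => ?_⟩
  rw [← LinearMap.adjoint_inner_right]
  have h := T.isSymmetric_adjoint_comp_self.apply_eigenvectorBasis hn j
  simp only [LinearMap.comp_apply] at h
  rw [h, inner_smul_right, OrthonormalBasis.inner_eq_ite, T.sq_singularValues_fin hn]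
  split_ifs with hij <;> simp [hij]

lemma norm_apply_le_singularValues_zero {n : ℕ} {F : Type*} [NormedAddCommGroup F]
    [InnerProductSpace ℝ F] [FiniteDimensional ℝ F] (T : EuclideanSpace ℝ (Fin n) →ₗ[ℝ] F)
    (x : EuclideanSpace ℝ (Fin n)) : ‖T x‖ ≤ T.singularValues 0 * ‖x‖ := by
  obtain ⟨b, hb⟩ := exists_singularBasis T
  have h0 := T.singularValues_nonneg 0
  refine le_of_sq_le_sq ?_ (by positivity)
  have h1 : ‖T x‖ ^ 2 = ∑ i, inner ℝ (b i) x ^ 2 * T.singularValues i ^ 2 := by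
    conv_lhs => rw [← b.sum_repr' x]
    rw [← real_inner_self_eq_norm_sq, map_sum, sum_inner]
    refine Finset.sum_congr rfl fun i _ => ?_
    simp only [map_smul, inner_sum, inner_smul_left, inner_smul_right, hb]
    simp [pow_two, mul_assoc]
  rw [h1, mul_pow, ← b.sum_sq_inner_right x, Finset.mul_sum]
  refine Finset.sum_le_sum fun i _ => ?_
  rw [mul_comm]
  gcongr
  · exact T.singularValues_nonneg i
  · exact T.singularValues_antitone (Nat.zero_le _)

lemma schattenOneNorm_eq_sum {m n : ℕ} (X : Matrix (Fin m) (Fin n) ℝ) :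
    schattenOneNorm X = ∑ i : Fin n, (Matrix.toEuclideanLin X).singularValues i := by
  rw [schattenOneNorm, Finsupp.sum, Finset.sum_subset (s₂ := Finset.range n),
    Finset.sum_range]
  · intro i hi
    by_contra h
    rw [Finsupp.mem_support_iff] at hi
    exact hi (LinearMap.singularValues_of_finrank_le _ (by simpa using h))
  · intro i _ hi
    exact Finsupp.notMem_support_iff.1 hi

lemma trace_transpose_mul_eq_sum_inner {m n : ℕ} (G X : Matrix (Fin m) (Fin n) ℝ)
    (b : OrthonormalBasis (Fin n) ℝ (EuclideanSpace ℝ (Fin n))) :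
    (Gᵀ * X).trace =
      ∑ i, inner ℝ (Matrix.toEuclideanLin G (b i)) (Matrix.toEuclideanLin X (b i)) := by
  have h : (Gᵀ * X).trace = LinearMap.trace ℝ _ (Matrix.toEuclideanLin (Gᵀ * X)) := by
    rw [Matrix.toEuclideanLin, Matrix.toLpLin_eq_toLin, Matrix.trace_toLin_eq]
  rw [h, LinearMap.trace_eq_sum_inner _ b]
  refine Finset.sum_congr rfl fun i _ => ?_
  rw [← LinearMap.adjoint_inner_right, ← Matrix.toEuclideanLin_conjTranspose_eq_adjoint]
  simp [Matrix.toLpLin_apply, Matrix.mulVec_mulVec]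

/-- Evaluate the trace in a right singular basis of `X`, where `‖X bᵢ‖` is the `i`th singular value,
and apply Cauchy–Schwarz to each term. -/
lemma trace_le_mul_schattenOneNorm {m n : ℕ} (G X : Matrix (Fin m) (Fin n) ℝ) {c : ℝ}
    (hG : ∀ x, ‖Matrix.toEuclideanLin G x‖ ≤ c * ‖x‖) :
    (Gᵀ * X).trace ≤ c * schattenOneNorm X := by
  obtain ⟨b, hb⟩ := exists_singularBasis (Matrix.toEuclideanLin X)
  rw [trace_transpose_mul_eq_sum_inner G X b, schattenOneNorm_eq_sum, Finset.mul_sum]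
  refine Finset.sum_le_sum fun i _ => (real_inner_le_norm _ _).trans ?_
  have h1 : ‖Matrix.toEuclideanLin X (b i)‖ = (Matrix.toEuclideanLin X).singularValues i := by
    have := hb i i
    rw [real_inner_self_eq_norm_sq, if_pos rfl] at this
    exact (sq_eq_sq₀ (norm_nonneg _) (LinearMap.singularValues_nonneg _ _)).1 this
  rw [h1]
  have h2 := hG (b i)
  rw [b.norm_eq_one, mul_one] at h2
  exact mul_le_mul_of_nonneg_right h2 (LinearMap.singularValues_nonneg _ _)

/-- The polar factor of `X` attains the Schatten 1-norm. -/
lemma exists_contraction_trace_eq {m n : ℕ} (X : Matrix (Fin m) (Fin n) ℝ) :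
    ∃ G : Matrix (Fin m) (Fin n) ℝ, (∀ x, ‖Matrix.toEuclideanLin G x‖ ≤ ‖x‖) ∧
      (Gᵀ * X).trace = schattenOneNorm X := by
  obtain ⟨b, hb⟩ := exists_singularBasis (Matrix.toEuclideanLin X)
  set T := Matrix.toEuclideanLin X with hT
  -- Since `0⁻¹ = 0`, `S` vanishes on the kernel directions of `T` and is isometric on the span of
  -- the others.
  set S : EuclideanSpace ℝ (Fin n) →ₗ[ℝ] EuclideanSpace ℝ (Fin m) :=
    b.toBasis.constr ℝ (fun i => (T.singularValues i)⁻¹ • T (b i)) with hS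
  have hSb : ∀ i, S (b i) = (T.singularValues i)⁻¹ • T (b i) := fun i => by
    rw [hS, ← b.coe_toBasis, Module.Basis.constr_basis]
  refine ⟨Matrix.toEuclideanLin.symm S, ?_, ?_⟩
  · intro x
    rw [LinearEquiv.apply_symm_apply]
    refine le_of_sq_le_sq ?_ (norm_nonneg _)
    have h1 : ‖S x‖ ^ 2 = ∑ i, inner ℝ (b i) x ^ 2 *
        ((T.singularValues i)⁻¹ ^ 2 * T.singularValues i ^ 2) := by
      conv_lhs => rw [← b.sum_repr' x]
      rw [← real_inner_self_eq_norm_sq, map_sum, sum_inner]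
      refine Finset.sum_congr rfl fun i _ => ?_
      simp only [map_smul, inner_sum, inner_smul_left, inner_smul_right, hb, hSb]
      simp only [mul_ite, mul_zero, Finset.sum_ite_eq, Finset.mem_univ, if_true, conj_trivial]
      ring
    rw [h1, ← b.sum_sq_inner_right x]
    refine Finset.sum_le_sum fun i _ => mul_le_of_le_one_right (sq_nonneg _) ?_
    rw [← mul_pow]
    by_cases h : T.singularValues i = 0
    · simp [h]
    · simp [h]
  · rw [trace_transpose_mul_eq_sum_inner _ _ b, schattenOneNorm_eq_sum]
    refine Finset.sum_congr rfl fun i _ => ?_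
    rw [LinearEquiv.apply_symm_apply, hSb, inner_smul_left, ← hT, hb, if_pos rfl]
    by_cases h : T.singularValues i = 0
    · simp [h]
    · simp [h, pow_two]

/-- The contraction that attains the norm of the combination bounds each summand from below by
duality, so convexity needs no further singular value analysis. -/
lemma schattenOneNorm_add_smul_le {m n : ℕ} (X Y : Matrix (Fin m) (Fin n) ℝ) {a b : ℝ}
    (ha : 0 ≤ a) (hb : 0 ≤ b) :
    schattenOneNorm (a • X + b • Y) ≤ a * schattenOneNorm X + b * schattenOneNorm Y := by
  obtain ⟨G, hG, h⟩ := exists_contraction_trace_eq (a • X + b • Y)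
  have h' : ∀ Z : Matrix (Fin m) (Fin n) ℝ, (Gᵀ * Z).trace ≤ schattenOneNorm Z := fun Z => by
    simpa using trace_le_mul_schattenOneNorm G Z (c := 1) (by simpa using hG)
  rw [← h, Matrix.mul_add, Matrix.trace_add, Matrix.mul_smul, Matrix.mul_smul,
    Matrix.trace_smul, Matrix.trace_smul, smul_eq_mul, smul_eq_mul]
  gcongr <;> exact h' _

lemma schattenOneNorm_vecMulVec_le {m n : ℕ} {α : ℝ} (hα : 0 ≤ α) {u : Fin m → ℝ}
    {v : Fin n → ℝ} (hu : u ⬝ᵥ u = 1) (hv : v ⬝ᵥ v = 1) :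
    schattenOneNorm (-(α • Matrix.vecMulVec u v)) ≤ α := by
  obtain ⟨G, hG, h⟩ := exists_contraction_trace_eq (-(α • Matrix.vecMulVec u v))
  have hnorm : ∀ {k : ℕ} (w : Fin k → ℝ), w ⬝ᵥ w = 1 → ‖WithLp.toLp 2 w‖ = 1 := by
    intro k w hw
    rw [EuclideanSpace.norm_eq, Real.sqrt_eq_one, ← hw, dotProduct]
    simp [pow_two]
  have h1 : (Gᵀ * (-(α • Matrix.vecMulVec u v))).trace =
      -(α * inner ℝ (WithLp.toLp 2 u) (Matrix.toEuclideanLin G (WithLp.toLp 2 v))) := by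
    rw [Matrix.mul_neg, Matrix.mul_smul, Matrix.trace_neg, Matrix.trace_smul,
      Matrix.mul_vecMulVec, Matrix.trace_vecMulVec, smul_eq_mul, Matrix.mulVec_transpose,
      ← Matrix.dotProduct_mulVec, EuclideanSpace.inner_eq_star_dotProduct]
    simp [Matrix.toLpLin_apply, dotProduct_comm]
  rw [← h, h1, ← mul_neg]
  refine mul_le_of_le_one_right hα ?_
  refine (neg_le_abs _).trans ((abs_real_inner_le_norm _ _).trans ?_)
  have := hG (WithLp.toLp 2 v)
  rw [hnorm v hv] at this
  rwa [hnorm u hu, one_mul]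

end SketchyCGM

/-! ### Convergence of the conditional gradient iterates -/

namespace SketchyCGM

noncomputable section

/-- The matrix iterates of the conditional gradient method, of which the dual iterates and the
sketches are linear images. -/
def primalIterate {m n : ℕ} (α : ℝ) (u : ℕ → Fin m → ℝ) (v : ℕ → Fin n → ℝ) :
    ℕ → Matrix (Fin m) (Fin n) ℝ
  | 0 => 0
  | t + 1 => (1 - stepSize t) • primalIterate α u v t + stepSize t • updateDir α u v t

lemma linMap_add_smul {m n d : ℕ} (A : Fin d → Matrix (Fin m) (Fin n) ℝ) (a b : ℝ)
    (X Y : Matrix (Fin m) (Fin n) ℝ) :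
    linMap A (a • X + b • Y) = a • linMap A X + b • linMap A Y := by
  ext i
  simp [linMap, Matrix.mul_add]

lemma linMap_sub {m n d : ℕ} (A : Fin d → Matrix (Fin m) (Fin n) ℝ)
    (X Y : Matrix (Fin m) (Fin n) ℝ) : linMap A (X - Y) = linMap A X - linMap A Y := by
  ext i
  simp [linMap, Matrix.mul_sub]

lemma inner_linMap {m n d : ℕ} (A : Fin d → Matrix (Fin m) (Fin n) ℝ)
    (z : EuclideanSpace ℝ (Fin d)) (X : Matrix (Fin m) (Fin n) ℝ) :
    inner ℝ z (linMap A X) = (Xᵀ * linMapAdj A z).trace := by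
  rw [← Matrix.trace_transpose, Matrix.transpose_mul, Matrix.transpose_transpose, linMapAdj,
    Matrix.transpose_sum, Matrix.sum_mul, Matrix.trace_sum, PiLp.inner_apply]
  simp [linMap, mul_comm]

section iterates

variable {m n d : ℕ} {α : ℝ} {A : Fin d → Matrix (Fin m) (Fin n) ℝ}
  {u : ℕ → Fin m → ℝ} {v : ℕ → Fin n → ℝ}

lemma dualIterate_eq (t : ℕ) : dualIterate α A u v t = linMap A (primalIterate α u v t) := by
  induction t with
  | zero => ext i; simp [dualIterate, primalIterate, linMap]
  | succ t ih => rw [dualIterate, primalIterate, linMap_add_smul, ih]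

lemma rangeSketch_eq {k : ℕ} (Om : Matrix (Fin n) (Fin k) ℝ) (t : ℕ) :
    rangeSketch α u v Om t = primalIterate α u v t * Om := by
  induction t with
  | zero => simp [rangeSketch, primalIterate]
  | succ t ih => simp [rangeSketch, primalIterate, ih, Matrix.add_mul]

lemma corangeSketch_eq {l : ℕ} (Psi : Matrix (Fin l) (Fin m) ℝ) (t : ℕ) :
    corangeSketch α u v Psi t = Psi * primalIterate α u v t := by
  induction t with
  | zero => simp [corangeSketch, primalIterate]
  | succ t ih => simp [corangeSketch, primalIterate, ih, Matrix.mul_add]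

lemma stepSize_pos (t : ℕ) : 0 < stepSize t := by unfold stepSize; positivity

lemma stepSize_le_one (t : ℕ) : stepSize t ≤ 1 := by
  unfold stepSize
  rw [div_le_one (by positivity)]
  linarith [t.cast_nonneg (α := ℝ)]

lemma feasible_primalIterate (hα : 0 ≤ α) (hu : ∀ t, u t ⬝ᵥ u t = 1) (hv : ∀ t, v t ⬝ᵥ v t = 1)
    (t : ℕ) : Feasible α (primalIterate α u v t) := by
  induction t with
  | zero =>
    -- Both coefficients are `0`, which yields that the norm of the zero matrix is at most `0`.
    have := schattenOneNorm_add_smul_le (0 : Matrix (Fin m) (Fin n) ℝ) 0 le_rfl le_rfl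
    simp only [zero_smul, add_zero, zero_mul] at this
    exact this.trans hα
  | succ t ih =>
    refine (schattenOneNorm_add_smul_le _ _ (sub_nonneg.2 (stepSize_le_one t))
      (stepSize_pos t).le).trans ?_
    calc _ ≤ (1 - stepSize t) * α + stepSize t * α := by
          gcongr
          · exact sub_nonneg.2 (stepSize_le_one t)
          · exact ih
          · exact (stepSize_pos t).le
          · exact schattenOneNorm_vecMulVec_le hα (hu t) (hv t)
      _ = α := by ring

/-- The update direction minimizes the linearized objective over the feasible set. -/
lemma trace_updateDir_le {G S : Matrix (Fin m) (Fin n) ℝ} {t : ℕ}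
    (h : IsMaxSingVec G (u t) (v t)) (hS : Feasible α S) :
    ((updateDir α u v t)ᵀ * G).trace ≤ (Sᵀ * G).trace := by
  obtain ⟨hu, -, hGv, -⟩ := h
  set s := (Matrix.toEuclideanLin G).singularValues 0 with hs
  have h1 : ((updateDir α u v t)ᵀ * G).trace = -(α * s) := by
    rw [← Matrix.trace_transpose, Matrix.transpose_mul, Matrix.transpose_transpose, updateDir,
      Matrix.mul_neg, Matrix.mul_smul, Matrix.trace_neg, Matrix.trace_smul,
      Matrix.mul_vecMulVec, Matrix.trace_vecMulVec, smul_eq_mul, Matrix.mulVec_transpose,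
      ← Matrix.dotProduct_mulVec, hGv, dotProduct_smul, hu]
    simp
  -- Duality for `-G`, whose operator norm is also `s`, bounds the linear functional below by `-(α *
  -- s)`, the value at the update direction.
  have h2 := trace_le_mul_schattenOneNorm (-G) S (c := s) fun x => by
    rw [map_neg, LinearMap.neg_apply, norm_neg]
    exact norm_apply_le_singularValues_zero _ x
  rw [Matrix.transpose_neg, Matrix.neg_mul, Matrix.trace_neg, ← Matrix.trace_transpose,
    Matrix.transpose_mul, Matrix.transpose_transpose] at h2
  have h3 : s * schattenOneNorm S ≤ s * α :=
    mul_le_mul_of_nonneg_left hS (LinearMap.singularValues_nonneg _ _)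
  rw [h1]
  linarith

end iterates

/-- The first order characterization of convexity. -/
lemma inner_gradient_sub_le {d : ℕ} {f : EuclideanSpace ℝ (Fin d) → ℝ}
    (hf : ConvexOn ℝ Set.univ f) {x : EuclideanSpace ℝ (Fin d)} (hd : DifferentiableAt ℝ f x)
    (y : EuclideanSpace ℝ (Fin d)) : inner ℝ (gradient f x) (y - x) ≤ f y - f x := by
  rw [inner_gradient_left]
  have hl : ConvexOn ℝ Set.univ (f ∘ AffineMap.lineMap (k := ℝ) x y) := by
    simpa using hf.comp_affineMap (AffineMap.lineMap x y : ℝ →ᵃ[ℝ] _)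
  have hder : HasDerivAt (f ∘ AffineMap.lineMap (k := ℝ) x y) (fderiv ℝ f x (y - x)) 0 := by
    have h1 : HasDerivAt (fun s : ℝ => AffineMap.lineMap (k := ℝ) x y s) (y - x) 0 :=
      AffineMap.hasDerivAt_lineMap
    have h2 : HasFDerivAt f (fderiv ℝ f x) (AffineMap.lineMap (k := ℝ) x y 0) := by
      simpa using hd.hasFDerivAt
    exact h2.comp_hasDerivAt 0 h1
  have := hl.le_slope_of_hasDerivAt (Set.mem_univ 0) (Set.mem_univ 1) one_pos hder
  simpa [slope_def_field] using this

/-- The supremum dominates its member at `(X, S, γ)`. Finiteness is essential, because `toReal`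
sends `⊤` to `0`. -/
lemma le_curvature {m n d : ℕ} {α : ℝ} {A : Fin d → Matrix (Fin m) (Fin n) ℝ}
    {f : EuclideanSpace ℝ (Fin d) → ℝ} {X S : Matrix (Fin m) (Fin n) ℝ} (hX : Feasible α X)
    (hS : Feasible α S) {γ : ℝ} (hγ : 0 < γ) (hγ1 : γ ≤ 1) (hC : curvature α A f ≠ ⊤) :
    f (linMap A (X + γ • (S - X))) ≤ f (linMap A X) + γ * ((S - X)ᵀ * objGrad A f X).trace
      + γ ^ 2 / 2 * (curvature α A f).toReal := by
  have h : ENNReal.ofReal (2 / γ ^ 2 * (f (linMap A (X + γ • (S - X))) - f (linMap A X)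
      - (((X + γ • (S - X)) - X)ᵀ * objGrad A f X).trace)) ≤ curvature α A f := by
    unfold curvature
    exact le_iSup_of_le X (le_iSup_of_le hX (le_iSup_of_le S (le_iSup_of_le hS
      (le_iSup_of_le γ (le_iSup_of_le ⟨hγ, hγ1⟩ le_rfl)))))
  rw [← ENNReal.ofReal_toReal hC, ENNReal.ofReal_le_ofReal_iff ENNReal.toReal_nonneg,
    add_sub_cancel_left, Matrix.transpose_smul, Matrix.smul_mul, Matrix.trace_smul,
    smul_eq_mul] at h
  have h2 := mul_le_mul_of_nonneg_left h (by positivity : 0 ≤ γ ^ 2 / 2)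
  rw [← mul_assoc, show γ ^ 2 / 2 * (2 / γ ^ 2) = 1 by field_simp, one_mul] at h2
  linarith

/-- The convergence rate of the conditional gradient method. -/
theorem objective_primalIterate_sub_le {m n d : ℕ} {α : ℝ} (hα : 0 ≤ α)
    {A : Fin d → Matrix (Fin m) (Fin n) ℝ} {f : EuclideanSpace ℝ (Fin d) → ℝ}
    (hfconv : ConvexOn ℝ Set.univ f) (hfdiff : ContDiff ℝ 1 f)
    {Xstar : Matrix (Fin m) (Fin n) ℝ} (hfeas : Feasible α Xstar)
    {u : ℕ → Fin m → ℝ} {v : ℕ → Fin n → ℝ}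
    (huv : ∀ t, IsMaxSingVec (linMapAdj A (gradient f (dualIterate α A u v t))) (u t) (v t))
    (hC : curvature α A f ≠ ⊤) {t : ℕ} (ht : 1 ≤ t) :
    f (linMap A (primalIterate α u v t)) - f (linMap A Xstar)
      ≤ 2 * (curvature α A f).toReal / (t + 2) := by
  set C := (curvature α A f).toReal with hCdef
  have hC0 : 0 ≤ C := ENNReal.toReal_nonneg
  have hfea : ∀ t, Feasible α (primalIterate α u v t) :=
    feasible_primalIterate hα (fun t => (huv t).1) (fun t => (huv t).2.1)
  -- In the curvature inequality the linear term is at most its value at `Xstar` in place of `H_t`,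
  -- which by convexity is at most minus the current gap.
  have step : ∀ t, f (linMap A (primalIterate α u v (t + 1))) - f (linMap A Xstar) ≤
      (1 - stepSize t) * (f (linMap A (primalIterate α u v t)) - f (linMap A Xstar))
        + stepSize t ^ 2 / 2 * C := by
    intro t
    set X := primalIterate α u v t with hX
    have hH : Feasible α (updateDir α u v t) :=
      schattenOneNorm_vecMulVec_le hα (huv t).1 (huv t).2.1
    have h1 := le_curvature (hfea t) hH
      (stepSize_pos t) (stepSize_le_one t) hC
    have h2 : primalIterate α u v (t + 1) = X + stepSize t • (updateDir α u v t - X) := by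
      rw [primalIterate, smul_sub, sub_smul, one_smul]; abel
    have h3 := huv t
    rw [dualIterate_eq] at h3
    have h4 := trace_updateDir_le h3 hfeas
    have h5 := inner_gradient_sub_le hfconv
      (hfdiff.differentiable (by simp) (linMap A X)) (linMap A Xstar)
    rw [← linMap_sub, inner_linMap, Matrix.transpose_sub, Matrix.sub_mul, Matrix.trace_sub] at h5
    rw [← hX, ← h2, Matrix.transpose_sub, Matrix.sub_mul, Matrix.trace_sub] at h1
    unfold objGrad at h1
    nlinarith [mul_le_mul_of_nonneg_left (h4.trans (sub_le_iff_le_add.1 h5))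
      (stepSize_pos t).le]
  -- The induction starts at `1`: since `η₀ = 1`, the first step erases the initial gap and leaves
  -- `C/2 ≤ 2C/3`.
  induction t, ht using Nat.le_induction with
  | base =>
    have := step 0
    simp only [stepSize, Nat.cast_zero] at this
    norm_num at this ⊢
    linarith
  | succ t ht ih =>
    refine (step t).trans ?_
    have h0 : (0 : ℝ) < t + 2 := by positivity
    have h1 : (1 - stepSize t) * (f (linMap A (primalIterate α u v t)) - f (linMap A Xstar)) ≤
        (1 - stepSize t) * (2 * C / (t + 2)) :=
      mul_le_mul_of_nonneg_left ih (sub_nonneg.2 (stepSize_le_one t))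
    refine (add_le_add_left h1 _).trans ?_
    have h2 : (1 - stepSize t) * (2 * C / (t + 2)) + stepSize t ^ 2 / 2 * C =
        2 * C * ((t + 1) / (t + 2) ^ 2) := by
      unfold stepSize; field_simp; ring
    rw [h2, div_eq_mul_one_div (2 * C)]
    refine mul_le_mul_of_nonneg_left ?_ (mul_nonneg zero_le_two hC0)
    -- What remains is `(t+1)(t+3) ≤ (t+2)²`.
    rw [div_le_div_iff₀ (by positivity) (by positivity)]
    push_cast
    nlinarith

/-- Under the growth condition the iterates converge at the stated rate. -/
theorem ofReal_norm_primalIterate_sub_le {m n d : ℕ} {α : ℝ} (hα : 0 ≤ α)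
    {A : Fin d → Matrix (Fin m) (Fin n) ℝ} {f : EuclideanSpace ℝ (Fin d) → ℝ}
    (hfconv : ConvexOn ℝ Set.univ f) (hfdiff : ContDiff ℝ 1 f)
    {κ ν : ℝ} (hκ : 0 < κ) (hν : 0 < ν)
    {Xstar : Matrix (Fin m) (Fin n) ℝ} (hfeas : Feasible α Xstar)
    (hgrowth : ∀ X : Matrix (Fin m) (Fin n) ℝ, Feasible α X →
      κ * ‖X - Xstar‖ ^ ν ≤ f (linMap A X) - f (linMap A Xstar))
    {u : ℕ → Fin m → ℝ} {v : ℕ → Fin n → ℝ}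
    (huv : ∀ t, IsMaxSingVec (linMapAdj A (gradient f (dualIterate α A u v t))) (u t) (v t))
    {t : ℕ} (ht : 1 ≤ t) :
    ENNReal.ofReal ‖primalIterate α u v t - Xstar‖ ≤
      (2 * curvature α A f / ENNReal.ofReal κ / ((t : ℝ≥0∞) + 2)) ^ (1 / ν) := by
  by_cases hC : curvature α A f = ⊤
  · rw [hC, ENNReal.mul_top two_ne_zero, ENNReal.top_div_of_ne_top ENNReal.ofReal_ne_top,
      ENNReal.top_div_of_ne_top (by finiteness), ENNReal.top_rpow_of_pos (by positivity)]
    exact le_top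
  have h1 := objective_primalIterate_sub_le hα hfconv hfdiff hfeas huv hC ht
  have h2 := (hgrowth _ (feasible_primalIterate hα (fun t => (huv t).1) (fun t => (huv t).2.1)
    t)).trans h1
  have h3 : ‖primalIterate α u v t - Xstar‖ ^ ν ≤
      2 * (curvature α A f).toReal / κ / (t + 2) := by
    rw [div_right_comm, le_div_iff₀ hκ, mul_comm]
    exact h2
  have h4 : ENNReal.ofReal (2 * (curvature α A f).toReal / κ / (t + 2)) =
      2 * curvature α A f / ENNReal.ofReal κ / ((t : ℝ≥0∞) + 2) := by
    rw [ENNReal.ofReal_div_of_pos (by positivity), ENNReal.ofReal_div_of_pos hκ,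
      ENNReal.ofReal_mul zero_le_two, ENNReal.ofReal_toReal hC,
      ENNReal.ofReal_add (by positivity) zero_le_two]
    simp
  rw [one_div, ENNReal.le_rpow_inv_iff hν, ← h4,
    ENNReal.ofReal_rpow_of_nonneg (norm_nonneg _) hν.le]
  exact ENNReal.ofReal_le_ofReal h3

end

end SketchyCGM

/-! ### Standard normal vectors and inverse chi-squared moments -/

namespace SketchyCGM

noncomputable section

/-- The standard normal distribution on `ι → ℝ`. -/
abbrev stdNormal (ι : Type*) [Fintype ι] : Measure (ι → ℝ) :=
  Measure.pi fun _ => gaussianReal 0 1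

section

variable {ι ι' : Type*} [Fintype ι] [Fintype ι']

/-- Images of standard normal vectors under linear maps with an isometric transpose are
standard normal. -/
lemma measurePreserving_stdNormal (L : (ι → ℝ) →ₗ[ℝ] (ι' → ℝ)) (Lt : (ι' → ℝ) → (ι → ℝ))
    (hadj : ∀ x y, L x ⬝ᵥ y = x ⬝ᵥ Lt y) (hiso : ∀ y, Lt y ⬝ᵥ Lt y = y ⬝ᵥ y) :
    MeasurePreserving L (stdNormal ι) (stdNormal ι') := by
  have hL : Measurable L := L.continuous_of_finiteDimensional.measurable
  refine ⟨hL, ?_⟩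
  -- The characteristic function of the image at `t` is that of the standard normal law at `Lt t`,
  -- which depends only on `‖Lt t‖ = ‖t‖`.
  have key : ((stdNormal ι).map L).map (WithLp.toLp 2) =
      (stdNormal ι').map (WithLp.toLp 2) := by
    rw [map_pi_eq_stdGaussian]
    have : IsProbabilityMeasure ((stdNormal ι).map L) := Measure.isProbabilityMeasure_map
      hL.aemeasurable
    have : IsProbabilityMeasure (((stdNormal ι).map L).map
      (WithLp.toLp 2 : (ι' → ℝ) → EuclideanSpace ℝ ι')) :=
      Measure.isProbabilityMeasure_map (by fun_prop)
    refine Measure.ext_of_charFun (E := EuclideanSpace ℝ ι') ?_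
    ext t
    have h1 : charFun (((stdNormal ι).map L).map (WithLp.toLp 2)) t =
        charFun ((stdNormal ι).map (WithLp.toLp 2)) (WithLp.toLp 2 (Lt t.ofLp)) := by
      rw [charFun_apply, charFun_apply, integral_map (by fun_prop) (by fun_prop),
        integral_map (by fun_prop) (by fun_prop), integral_map (by fun_prop) (by fun_prop)]
      congr 1
      ext x
      have h2 := hadj x t.ofLp
      congr 2
      simp only [EuclideanSpace.inner_eq_star_dotProduct, star_trivial]
      rw [dotProduct_comm, h2, dotProduct_comm]
    rw [h1, map_pi_eq_stdGaussian, charFun_stdGaussian, charFun_stdGaussian]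
    congr 2
    have h3 : ‖WithLp.toLp 2 (Lt t.ofLp)‖ ^ 2 = ‖t‖ ^ 2 := by
      rw [← real_inner_self_eq_norm_sq, ← real_inner_self_eq_norm_sq,
        EuclideanSpace.inner_eq_star_dotProduct, EuclideanSpace.inner_eq_star_dotProduct]
      exact hiso _
    exact_mod_cast congrArg (fun a : ℝ => -(a : ℂ)) h3
  have := congrArg (Measure.map (WithLp.ofLp : EuclideanSpace ℝ ι' → _)) key
  simp only [Measure.map_map (WithLp.measurable_ofLp 2 (ι' → ℝ)) (WithLp.measurable_toLp 2 (ι' → ℝ)),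
    Function.comp_def, Measure.map_id'] at this
  exact this

/-- Independence of complementary groups of coordinates. -/
lemma measurePreserving_sumElim {κ : Type*} [Fintype κ] (e : κ ≃ ι ⊕ ι') :
    MeasurePreserving (fun (p : (ι → ℝ) × (ι' → ℝ)) (i : κ) => Sum.elim p.1 p.2 (e i))
      ((stdNormal ι).prod (stdNormal ι')) (stdNormal κ) := by
  have h1 := (measurePreserving_sumPiEquivProdPi
    (fun _ : ι ⊕ ι' => gaussianReal 0 1)).symm
  have h2 := measurePreserving_piCongrLeft (fun _ : κ => gaussianReal 0 1) e.symm
  convert h2.comp h1 using 1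
  ext p i
  obtain ⟨j, rfl⟩ := e.symm.surjective i
  rw [Function.comp_apply, MeasurableEquiv.coe_piCongrLeft, Equiv.piCongrLeft_apply_apply,
    Equiv.apply_symm_apply, MeasurableEquiv.coe_sumPiEquivProdPi_symm]
  cases j <;> rfl

lemma lintegral_stdNormal_split {κ : Type*} [Fintype κ] (e : κ ≃ ι ⊕ ι')
    {f : (κ → ℝ) → ℝ≥0∞} (hf : Measurable f) :
    ∫⁻ x, f x ∂stdNormal κ =
      ∫⁻ y, ∫⁻ z, f (fun i => Sum.elim y z (e i)) ∂stdNormal ι' ∂stdNormal ι := by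
  have h := measurePreserving_sumElim e
  rw [← h.lintegral_comp hf]
  exact lintegral_prod _ (hf.comp h.measurable).aemeasurable

/-- The sum has mean zero, so its second moment is its variance, which is additive over independent
coordinates. -/
lemma lintegral_sq_sum_stdNormal (c : ι → ℝ) :
    ∫⁻ x, ENNReal.ofReal ((∑ i, c i * x i) ^ 2) ∂stdNormal ι =
      ENNReal.ofReal (∑ i, c i ^ 2) := by
  have hm : ∀ i, MemLp (fun y : ℝ => c i * y) 2 (gaussianReal 0 1) := fun i =>
    (memLp_id_gaussianReal (μ := 0) (v := 1) 2).const_mul (c i)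
  have hm' : ∀ i, MemLp (fun x : ι → ℝ => c i * x i) 2 (stdNormal ι) := fun i =>
    (hm i).comp_measurePreserving (measurePreserving_eval (fun _ : ι => gaussianReal 0 1) i)
  have h1 := variance_sum_pi (μ := fun _ : ι => gaussianReal 0 1) (X := fun i y => c i * y) hm
  have h2 : ∀ i, Var[fun y => c i * y; gaussianReal 0 1] = c i ^ 2 := fun i => by
    rw [variance_const_mul]
    have : Var[fun y : ℝ => y; gaussianReal 0 1] = 1 := by
      exact variance_id_gaussianReal (μ := 0) (v := 1)
    rw [this, mul_one]
  simp_rw [h2] at h1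
  have hsum : (∑ i, fun x : ι → ℝ => c i * x i) = fun x => ∑ i, c i * x i := by
    ext x; simp
  have hmean : ∫ x, ∑ i, c i * x i ∂stdNormal ι = 0 := by
    rw [integral_finsetSum _ fun i _ => (hm' i).integrable (by norm_num)]
    refine Finset.sum_eq_zero fun i _ => ?_
    rw [integral_const_mul]
    have h3 : ∫ x : ι → ℝ, x i ∂stdNormal ι = ∫ y, y ∂gaussianReal 0 1 := by
      rw [← (measurePreserving_eval (fun _ : ι => gaussianReal 0 1) i).map_eq,
        integral_map (measurable_pi_apply i).aemeasurable (by fun_prop)]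
    rw [h3, integral_id_gaussianReal, mul_zero]
  rw [hsum] at h1
  have hL : MemLp (fun x : ι → ℝ => ∑ i, c i * x i) 2 (stdNormal ι) :=
    memLp_finsetSum _ fun i _ => hm' i
  rw [← h1, hL.ofReal_variance_eq, evariance_eq_lintegral_ofReal, hmean]
  simp

lemma integral_exp_neg_mul_sq_gaussianReal {s : ℝ} (hs : 0 ≤ s) :
    ∫ x, Real.exp (-s * x ^ 2) ∂gaussianReal 0 1 = (1 + 2 * s) ^ (-(1 / 2) : ℝ) := by
  rw [integral_gaussianReal_eq_integral_smul one_ne_zero]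
  have h : ∀ x : ℝ, gaussianPDFReal 0 1 x • Real.exp (-s * x ^ 2) =
      (√(2 * Real.pi))⁻¹ * Real.exp (-(s + 1 / 2) * x ^ 2) := fun x => by
    rw [gaussianPDFReal_def, smul_eq_mul, mul_assoc, ← Real.exp_add]
    simp only [NNReal.coe_one, mul_one]
    congr 2
    ring
  simp_rw [h]
  rw [integral_const_mul, integral_gaussian, Real.rpow_neg (by positivity),
    ← Real.sqrt_eq_rpow, ← Real.sqrt_inv, ← Real.sqrt_mul (by positivity), ← Real.sqrt_inv]
  congr 1
  field_simp
  ring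

lemma lintegral_exp_neg_mul_sum_sq_stdNormal {s : ℝ} (hs : 0 ≤ s) :
    ∫⁻ x, ENNReal.ofReal (Real.exp (-s * ∑ i, x i ^ 2)) ∂stdNormal ι =
      ENNReal.ofReal ((1 + 2 * s) ^ (-(Fintype.card ι / 2) : ℝ)) := by
  have h : ∀ x : ι → ℝ, Real.exp (-s * ∑ i, x i ^ 2) = ∏ i, Real.exp (-s * x i ^ 2) := fun x => by
    rw [Finset.mul_sum, Real.exp_sum]
  have hb : ∀ x : ι → ℝ, ‖Real.exp (-s * ∑ i, x i ^ 2)‖ ≤ 1 := fun x => by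
    rw [Real.norm_of_nonneg (Real.exp_nonneg _), Real.exp_le_one_iff, neg_mul, neg_nonpos]
    positivity
  rw [← ofReal_integral_eq_lintegral_ofReal
    (Integrable.of_bound (Measurable.aestronglyMeasurable (by fun_prop)) 1 (Filter.Eventually.of_forall hb))
    (Filter.Eventually.of_forall fun x => Real.exp_nonneg _)]
  simp_rw [h]
  rw [integral_fintype_prod_eq_prod (fun (_ : ι) (y : ℝ) => Real.exp (-s * y ^ 2))]
  simp_rw [integral_exp_neg_mul_sq_gaussianReal hs]
  rw [Finset.prod_const, Finset.card_univ, ← Real.rpow_natCast, ← Real.rpow_mul (by positivity)]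
  congr 2
  ring

/-- This represents the inverse of a sum of squares by exponentials, whose Gaussian expectation
factors over coordinates. At `a = 0` both sides are `⊤`. -/
lemma lintegral_exp_neg_mul_Ioi {a : ℝ} (ha : 0 ≤ a) :
    ∫⁻ s in Set.Ioi (0 : ℝ), ENNReal.ofReal (Real.exp (-s * a)) = (ENNReal.ofReal a)⁻¹ := by
  rcases ha.eq_or_lt with rfl | ha
  · simp
  have hi : IntegrableOn (fun s => Real.exp (-a * s)) (Set.Ioi 0) :=
    integrableOn_exp_mul_Ioi (neg_neg_iff_pos.2 ha) 0
  have h := integral_exp_mul_Ioi (neg_neg_iff_pos.2 ha) 0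
  simp_rw [show ∀ s : ℝ, -s * a = -a * s from fun s => by ring]
  rw [← ofReal_integral_eq_lintegral_ofReal hi
    (Filter.Eventually.of_forall fun x => Real.exp_nonneg _), h,
    ← ENNReal.ofReal_inv_of_pos ha]
  simp

lemma lintegral_one_add_two_mul_rpow {p : ℝ} (hp : 2 < p) :
    ∫⁻ s in Set.Ioi (0 : ℝ), ENNReal.ofReal ((1 + 2 * s) ^ (-(p / 2))) =
      ENNReal.ofReal (1 / (p - 2)) := by
  have hp' : p - 2 ≠ 0 := by linarith
  have hd : ∀ s ∈ Set.Ici (0 : ℝ), HasDerivAt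
      (fun s : ℝ => -(1 / (p - 2)) * (1 + 2 * s) ^ (-((p - 2) / 2)))
      ((1 + 2 * s) ^ (-(p / 2))) s := by
    intro s hs
    have hs' : (0 : ℝ) < 1 + 2 * s := by have := Set.mem_Ici.1 hs; linarith
    have h1 : HasDerivAt (fun s : ℝ => 1 + 2 * s) 2 s := by
      simpa using ((hasDerivAt_id s).const_mul 2).const_add 1
    have h2 := (h1.rpow_const (p := -((p - 2) / 2)) (Or.inl hs'.ne')).const_mul (-(1 / (p - 2)))
    rw [show -((p - 2) / 2) - 1 = -(p / 2) by ring] at h2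
    refine h2.congr_deriv ?_
    field_simp
  have hn : ∀ s ∈ Set.Ioi (0 : ℝ), 0 ≤ (1 + 2 * s) ^ (-(p / 2)) := fun s hs =>
    Real.rpow_nonneg (by have := Set.mem_Ioi.1 hs; linarith) _
  have ht : Filter.Tendsto (fun s : ℝ => -(1 / (p - 2)) * (1 + 2 * s) ^ (-((p - 2) / 2)))
      Filter.atTop (nhds (-(1 / (p - 2)) * 0)) := by
    refine Filter.Tendsto.const_mul _ ((tendsto_rpow_neg_atTop (by linarith)).comp ?_)
    exact Filter.tendsto_atTop_add_const_left _ _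
      (Filter.tendsto_id.const_mul_atTop two_pos)
  rw [← ofReal_integral_eq_lintegral_ofReal (integrableOn_Ioi_deriv_of_nonneg' hd hn ht)
    ((ae_restrict_iff' measurableSet_Ioi).2 (Filter.Eventually.of_forall hn)),
    integral_Ioi_of_hasDerivAt_of_nonneg' hd hn ht]
  simp

/-- The expected inverse of a chi-squared variable. -/
lemma lintegral_inv_sum_sq_stdNormal (hι : 2 < Fintype.card ι) :
    ∫⁻ x, (ENNReal.ofReal (∑ i, x i ^ 2))⁻¹ ∂stdNormal ι =
      ENNReal.ofReal (1 / ((Fintype.card ι : ℝ) - 2)) := by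
  have h : ∀ x : ι → ℝ, (ENNReal.ofReal (∑ i, x i ^ 2))⁻¹ =
      ∫⁻ s in Set.Ioi (0 : ℝ), ENNReal.ofReal (Real.exp (-s * ∑ i, x i ^ 2)) := fun x =>
    (lintegral_exp_neg_mul_Ioi (by positivity)).symm
  simp_rw [h]
  rw [lintegral_lintegral_swap (by fun_prop),
    ← lintegral_one_add_two_mul_rpow (p := Fintype.card ι) (by exact_mod_cast hι)]
  refine setLIntegral_congr_fun measurableSet_Ioi fun s hs => ?_
  exact lintegral_exp_neg_mul_sum_sq_stdNormal (le_of_lt hs)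

end

end

end SketchyCGM

/-! ### Distances of Gaussian rows to the span of the other rows -/

namespace SketchyCGM

noncomputable section

section

variable {q l : Type*} [Fintype q] [Fintype l]

/-- A countable infimum is needed for the measurability of distances to random subspaces. -/
lemma infDist_range_comp_denseSeq {α E : Type*} [TopologicalSpace α]
    [TopologicalSpace.SeparableSpace α] [Nonempty α] [PseudoMetricSpace E] {φ : α → E}
    (hφ : Continuous φ) (x : E) :
    Metric.infDist x (Set.range φ) = ⨅ n, dist x (φ (TopologicalSpace.denseSeq α n)) := by
  have h1 : closure (Set.range (φ ∘ TopologicalSpace.denseSeq α)) = closure (Set.range φ) := by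
    refine subset_antisymm (closure_mono (Set.range_comp_subset_range _ _))
      (closure_minimal ?_ isClosed_closure)
    rw [Set.range_comp, ← Set.image_univ,
      ← (TopologicalSpace.denseRange_denseSeq α).closure_range]
    exact image_closure_subset_closure_image hφ
  rw [← Metric.infDist_closure, ← h1, Metric.infDist_closure, Metric.infDist_eq_iInf]
  exact iInf_range' (fun y => dist x y) _

/-- The distance to the span of finitely many vectors depends measurably on the data. -/
lemma measurable_infDist_span {Ω : Type*} [MeasurableSpace Ω] {E : Type*} [NormedAddCommGroup E]
    [InnerProductSpace ℝ E] [FiniteDimensional ℝ E] [MeasurableSpace E] [BorelSpace E]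
    {x : Ω → E} {c : Ω → q → E} (hx : Measurable x) (hc : ∀ j, Measurable fun ω => c ω j) :
    Measurable fun ω => Metric.infDist (x ω) (Submodule.span ℝ (Set.range (c ω)) : Set E) := by
  have h : ∀ ω, Metric.infDist (x ω) (Submodule.span ℝ (Set.range (c ω)) : Set E) =
      ⨅ n, dist (x ω) (∑ j, TopologicalSpace.denseSeq (q → ℝ) n j • c ω j) := fun ω => by
    have h1 : (Submodule.span ℝ (Set.range (c ω)) : Set E) =
        Set.range fun a : q → ℝ => ∑ j, a j • c ω j := by
      ext y
      rw [SetLike.mem_coe, Submodule.mem_span_range_iff_exists_fun, Set.mem_range]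
    rw [h1]
    exact infDist_range_comp_denseSeq (by fun_prop) _
  simp_rw [h]
  refine Measurable.iInf fun n => hx.dist (Finset.measurable_sum _ fun j _ => ?_)
  exact (hc j).const_smul _

lemma infDist_submodule_eq_norm {E : Type*} [NormedAddCommGroup E]
    [InnerProductSpace ℝ E] (K : Submodule ℝ E) [K.HasOrthogonalProjection] (x : E) :
    Metric.infDist x K = ‖x - K.starProjection x‖ := by
  rw [Submodule.starProjection_minimal, Metric.infDist_eq_iInf]
  simp [dist_eq_norm]

/-- The expected inverse squared distance of a standard normal vector to a subspace. -/
lemma lintegral_inv_infDist_sq_stdNormal (K : Submodule ℝ (EuclideanSpace ℝ l))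
    (hK : Module.finrank ℝ K + 2 < Fintype.card l) :
    ∫⁻ z, (ENNReal.ofReal (Metric.infDist (WithLp.toLp 2 z) (K : Set (EuclideanSpace ℝ l)) ^ 2))⁻¹
      ∂stdNormal l = ENNReal.ofReal (1 / ((Fintype.card l : ℝ) - Module.finrank ℝ K - 2)) := by
  set b := stdOrthonormalBasis ℝ Kᗮ with hb
  have hfr : Module.finrank ℝ K + Module.finrank ℝ Kᗮ = Fintype.card l := by
    rw [Submodule.finrank_add_finrank_orthogonal, finrank_euclideanSpace]
  -- `L` takes coordinates in an orthonormal basis of `Kᗮ`; hence the squared distance to `K` is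
  -- chi-squared with `card l - finrank K` degrees of freedom.
  let L : (l → ℝ) →ₗ[ℝ] (Fin (Module.finrank ℝ Kᗮ) → ℝ) :=
    { toFun := fun z i => inner ℝ (b i : EuclideanSpace ℝ l) (WithLp.toLp 2 z)
      map_add' := fun x y => by ext i; simp [WithLp.toLp_add, inner_add_right]
      map_smul' := fun a x => by ext i; simp [WithLp.toLp_smul, inner_smul_right] }
  let Lt : (Fin (Module.finrank ℝ Kᗮ) → ℝ) → (l → ℝ) :=
    fun y => WithLp.ofLp (∑ i, y i • (b i : EuclideanSpace ℝ l))
  have hin : ∀ x y : EuclideanSpace ℝ l, x.ofLp ⬝ᵥ y.ofLp = inner ℝ x y := fun x y => by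
    rw [EuclideanSpace.inner_eq_star_dotProduct, star_trivial, dotProduct_comm]
  have hon : Orthonormal ℝ fun i => (b i : EuclideanSpace ℝ l) :=
    b.orthonormal.comp_linearIsometry Kᗮ.subtypeₗᵢ
  have hmp := measurePreserving_stdNormal L Lt
    (fun x y => by
      have h : x ⬝ᵥ Lt y = inner ℝ (WithLp.toLp 2 x) (∑ i, y i • (b i : EuclideanSpace ℝ l)) :=
        hin _ _
      rw [h, inner_sum]
      refine Finset.sum_congr rfl fun i _ => ?_
      rw [inner_smul_right, real_inner_comm, mul_comm]
      rfl)
    (fun y => by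
      have h : Lt y ⬝ᵥ Lt y = _ := hin _ _
      rw [h, hon.inner_sum]
      rfl)
  have hdist : ∀ z, Metric.infDist (WithLp.toLp 2 z) (K : Set (EuclideanSpace ℝ l)) ^ 2 =
      ∑ i, L z i ^ 2 := fun z => by
    rw [infDist_submodule_eq_norm, ← Submodule.starProjection_orthogonal_val,
      Submodule.starProjection_apply, Submodule.norm_coe, ← b.sum_sq_inner_right]
    refine Finset.sum_congr rfl fun i _ => ?_
    rw [Submodule.inner_orthogonalProjectionOnto_eq_of_mem_left]
    rfl
  simp_rw [hdist]
  rw [hmp.lintegral_comp (f := fun y => (ENNReal.ofReal (∑ i, y i ^ 2))⁻¹) (by fun_prop),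
    lintegral_inv_sum_sq_stdNormal (by rw [Fintype.card_fin]; omega), Fintype.card_fin]
  congr 3
  rw [← hfr]
  push_cast
  ring

/-- The matrix with the given family of entries. -/
def toMat (x : q × l → ℝ) : Matrix q l ℝ := Matrix.of fun i j => x (i, j)

/-- The distance of the `i`th row of a matrix to the span of the other rows. -/
def rowDist (G : Matrix q l ℝ) (i : q) : ℝ :=
  Metric.infDist (WithLp.toLp 2 (G i)) (Submodule.span ℝ
    (Set.range fun j : {j // j ≠ i} => (WithLp.toLp 2 (G j) : EuclideanSpace ℝ l)) : Set _)

/-- The sum of the inverse squared distances of the rows to the span of the other rows. -/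
def invDistSum (G : Matrix q l ℝ) : ℝ≥0∞ := ∑ i, (ENNReal.ofReal (rowDist G i ^ 2))⁻¹

lemma measurable_rowDist (i : q) : Measurable fun x : q × l → ℝ => rowDist (toMat x) i := by
  classical
  refine measurable_infDist_span ?_ fun j => ?_ <;>
  · refine (WithLp.measurable_toLp 2 _).comp (measurable_pi_lambda _ fun b => ?_)
    exact measurable_pi_apply _

/-- The entries of a matrix are those outside the `i`th row and those of the `i`th row. -/
def rowEquiv [DecidableEq q] (i : q) : q × l ≃ ({j // j ≠ i} × l) ⊕ l where
  toFun p := if h : p.1 = i then Sum.inr p.2 else Sum.inl (⟨p.1, h⟩, p.2)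
  invFun := Sum.elim (fun y => (y.1.1, y.2)) fun b => (i, b)
  left_inv p := by
    rcases p with ⟨j, b⟩
    by_cases h : j = i
    · subst h; simp
    · simp [h]
  right_inv s := by
    rcases s with ⟨⟨j, hj⟩, b⟩ | b
    · simp [hj]
    · simp

/-- With the other rows fixed, the `i`th row is still standard normal, and their span has dimension
at most `card q - 1`. -/
lemma lintegral_inv_rowDist_sq_le (hql : Fintype.card q + 2 ≤ Fintype.card l) (i : q) :
    ∫⁻ x, (ENNReal.ofReal (rowDist (toMat x) i ^ 2))⁻¹ ∂stdNormal (q × l) ≤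
      ENNReal.ofReal (1 / ((Fintype.card l : ℝ) - Fintype.card q - 1)) := by
  classical
  rw [lintegral_stdNormal_split (rowEquiv i)
    (f := fun x => (ENNReal.ofReal (rowDist (toMat x) i ^ 2))⁻¹)
    ((((measurable_rowDist i).pow_const 2).ennreal_ofReal).inv)]
  refine (lintegral_mono (g := fun _ => ENNReal.ofReal
    (1 / ((Fintype.card l : ℝ) - Fintype.card q - 1))) fun y => ?_).trans (by simp)
  set K : Submodule ℝ (EuclideanSpace ℝ l) := Submodule.span ℝ
    (Set.range fun j : {j // j ≠ i} => (WithLp.toLp 2 fun b => y (j, b) : EuclideanSpace ℝ l))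
    with hKdef
  have h1 : ∀ z : l → ℝ, rowDist (toMat fun p => Sum.elim y z (rowEquiv i p)) i =
      Metric.infDist (WithLp.toLp 2 z) (K : Set (EuclideanSpace ℝ l)) := fun z => by
    have h2 : ∀ j : {j // j ≠ i},
        toMat (fun p => Sum.elim y z (rowEquiv i p)) j = fun b => y (j, b) := fun j => by
      ext b
      simp [toMat, rowEquiv, j.2]
    have h3 : toMat (fun p => Sum.elim y z (rowEquiv i p)) i = z := by
      ext b
      simp [toMat, rowEquiv]
    rw [rowDist, h3, hKdef]
    simp_rw [h2]
  have hK : Module.finrank ℝ K + 1 ≤ Fintype.card q := by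
    have h2 : Module.finrank ℝ K ≤ Fintype.card {j // j ≠ i} := finrank_range_le_card _
    have h3 : Fintype.card {j // j ≠ i} = Fintype.card q - 1 := by
      simp
    have h4 : 0 < Fintype.card q := Fintype.card_pos_iff.2 ⟨i⟩
    omega
  simp_rw [h1]
  rw [lintegral_inv_infDist_sq_stdNormal K (by omega)]
  have hK' : (Module.finrank ℝ K : ℝ) + 1 ≤ Fintype.card q := by exact_mod_cast hK
  have hql' : (Fintype.card q : ℝ) + 2 ≤ Fintype.card l := by exact_mod_cast hql
  refine ENNReal.ofReal_le_ofReal (one_div_le_one_div_of_le ?_ ?_) <;> linarith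

/-- The `q` rows contribute at most `1/(ℓ-q-1)` each, and `ℓ ≥ 2q+1` says that `ℓ-q-1 ≥ q`. The
sketch sizes `k = 2r+1` and `ℓ = 2k+1` come from here. -/
lemma lintegral_invDistSum_le_one (hql : 2 * Fintype.card q + 1 ≤ Fintype.card l) :
    ∫⁻ x, invDistSum (toMat x) ∂stdNormal (q × l) ≤ 1 := by
  unfold invDistSum
  have hm : ∀ i : q, Measurable fun x : q × l → ℝ =>
      (ENNReal.ofReal (rowDist (toMat x) i ^ 2))⁻¹ := fun i =>
    (((measurable_rowDist i).pow_const 2).ennreal_ofReal).inv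
  rw [lintegral_finsetSum _ fun i _ => hm i]
  rcases isEmpty_or_nonempty q with hq | hq
  · simp
  have hq0 : 0 < Fintype.card q := Fintype.card_pos
  refine (Finset.sum_le_sum fun i _ => lintegral_inv_rowDist_sq_le (by omega) i).trans ?_
  have hq1 : (0 : ℝ) < Fintype.card q := by exact_mod_cast hq0
  have hql' : 2 * (Fintype.card q : ℝ) + 1 ≤ Fintype.card l := by exact_mod_cast hql
  rw [Finset.sum_const, Finset.card_univ, nsmul_eq_mul, ← ENNReal.ofReal_natCast,
    ← ENNReal.ofReal_mul hq1.le, ENNReal.ofReal_le_one, mul_one_div, div_le_one] <;> linarith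

end

end

end SketchyCGM

/-! ### Frobenius norm, orthogonal projections and right inverses -/

namespace SketchyCGM

noncomputable section

section

variable {m n q l p : Type*} [Fintype m] [Fintype n] [Fintype q] [Fintype l] [Fintype p]

lemma norm_sq_eq_sum (A : Matrix m n ℝ) : ‖A‖ ^ 2 = ∑ i, ∑ j, A i j ^ 2 := by
  rw [Matrix.frobenius_norm_def, ← Real.sqrt_eq_rpow, Real.sq_sqrt (by positivity)]
  simp

lemma norm_sq_eq_trace (A : Matrix m n ℝ) : ‖A‖ ^ 2 = (Aᵀ * A).trace := by
  rw [norm_sq_eq_sum, Finset.sum_comm]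
  simp [Matrix.trace, Matrix.mul_apply, pow_two]

lemma norm_add_sq_of_transpose_mul_eq_zero {A B : Matrix m n ℝ} (h : Aᵀ * B = 0) :
    ‖A + B‖ ^ 2 = ‖A‖ ^ 2 + ‖B‖ ^ 2 := by
  have h' : Bᵀ * A = 0 := by
    rw [← Matrix.transpose_inj, Matrix.transpose_mul, Matrix.transpose_transpose, h,
      Matrix.transpose_zero]
  simp only [norm_sq_eq_trace, Matrix.transpose_add, Matrix.add_mul, Matrix.mul_add, h, h',
    add_zero, zero_add, Matrix.trace_add]

lemma norm_add_sq_of_mul_transpose_eq_zero {A B : Matrix m n ℝ} (h : A * Bᵀ = 0) :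
    ‖A + B‖ ^ 2 = ‖A‖ ^ 2 + ‖B‖ ^ 2 := by
  have := norm_add_sq_of_transpose_mul_eq_zero (A := Aᵀ) (B := Bᵀ) (by simpa using h)
  rwa [← Matrix.transpose_add, Matrix.frobenius_norm_transpose, Matrix.frobenius_norm_transpose,
    Matrix.frobenius_norm_transpose] at this

lemma norm_mul_of_transpose_mul_self [DecidableEq q] {Q : Matrix m q ℝ} (hQ : Qᵀ * Q = 1)
    (A : Matrix q n ℝ) : ‖Q * A‖ = ‖A‖ := by
  rw [← sq_eq_sq₀ (norm_nonneg _) (norm_nonneg _), norm_sq_eq_trace, norm_sq_eq_trace,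
    Matrix.transpose_mul, Matrix.mul_assoc, ← Matrix.mul_assoc Qᵀ, hQ, Matrix.one_mul]

lemma norm_mul_transpose_of_transpose_mul_self [DecidableEq q] {Q : Matrix m q ℝ}
    (hQ : Qᵀ * Q = 1) (A : Matrix n q ℝ) : ‖A * Qᵀ‖ = ‖A‖ := by
  rw [← Matrix.frobenius_norm_transpose, Matrix.transpose_mul, Matrix.transpose_transpose,
    norm_mul_of_transpose_mul_self hQ, Matrix.frobenius_norm_transpose]

lemma norm_projection_mul_le [DecidableEq m] {P : Matrix m m ℝ} (hP : P * P = P) (hPt : Pᵀ = P)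
    (A : Matrix m n ℝ) : ‖P * A‖ ≤ ‖A‖ := by
  refine le_of_sq_le_sq ?_ (norm_nonneg _)
  have h : ‖P * A + (1 - P) * A‖ ^ 2 = ‖P * A‖ ^ 2 + ‖(1 - P) * A‖ ^ 2 := by
    refine norm_add_sq_of_transpose_mul_eq_zero ?_
    rw [Matrix.transpose_mul, hPt, Matrix.mul_assoc, ← Matrix.mul_assoc P, Matrix.mul_sub, hP]
    simp
  rw [← Matrix.add_mul, add_sub_cancel, Matrix.one_mul] at h
  rw [h]
  exact le_add_of_nonneg_right (sq_nonneg _)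

lemma norm_mul_projection_le [DecidableEq n] {P : Matrix n n ℝ} (hP : P * P = P) (hPt : Pᵀ = P)
    (A : Matrix m n ℝ) : ‖A * P‖ ≤ ‖A‖ := by
  rw [← Matrix.frobenius_norm_transpose, Matrix.transpose_mul, hPt,
    ← Matrix.frobenius_norm_transpose A]
  exact norm_projection_mul_le hP hPt _

lemma mul_transpose_self_mul_self [DecidableEq q] {Q : Matrix m q ℝ} (hQ : Qᵀ * Q = 1) :
    Q * Qᵀ * (Q * Qᵀ) = Q * Qᵀ := by
  rw [Matrix.mul_assoc, ← Matrix.mul_assoc Qᵀ, hQ, Matrix.one_mul]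

lemma transpose_mul_transpose_self {m q : Type*} [Fintype q] (Q : Matrix m q ℝ) : (Q * Qᵀ)ᵀ = Q * Qᵀ := by simp

lemma mul_eq_self_of_range_le {P : Matrix m m ℝ} (hP : P * P = P) {A : Matrix m n ℝ}
    (h : LinearMap.range A.mulVecLin ≤ LinearMap.range P.mulVecLin) : P * A = A := by
  classical
  refine Matrix.ext_of_mulVec_single fun j => ?_
  obtain ⟨y, hy⟩ := h ⟨Pi.single j 1, rfl⟩
  rw [Matrix.mulVecLin_apply, Matrix.mulVecLin_apply] at hy
  rw [← Matrix.mulVec_mulVec, ← hy, Matrix.mulVec_mulVec, hP]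

/-- Every subspace has an orthonormal basis, which we write as the columns of a matrix. -/
lemma exists_orthonormal_columns (K : Submodule ℝ (m → ℝ)) :
    ∃ (k : ℕ) (Q : Matrix m (Fin k) ℝ), k = Module.finrank ℝ K ∧
      Qᵀ * Q = 1 ∧ LinearMap.range Q.mulVecLin = K := by
  let e := WithLp.linearEquiv 2 ℝ (m → ℝ)
  let K' : Submodule ℝ (EuclideanSpace ℝ m) := K.map e.symm.toLinearMap
  have hfr : Module.finrank ℝ K' = Module.finrank ℝ K := LinearEquiv.finrank_map_eq e.symm K
  let b := (stdOrthonormalBasis ℝ K').reindex (finCongr hfr)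
  refine ⟨_, Matrix.of fun i j => (b j : EuclideanSpace ℝ m) i, rfl, ?_, ?_⟩
  · ext i j
    have h := b.inner_eq_ite i j
    rw [Submodule.coe_inner, PiLp.inner_apply] at h
    rw [Matrix.mul_apply, Matrix.one_apply, ← h]
    simp [mul_comm]
  · rw [Matrix.range_mulVecLin]
    have h1 : Submodule.span ℝ (Set.range fun j => (b j : EuclideanSpace ℝ m)) = K' := by
      have := congrArg (Submodule.map K'.subtype) b.toBasis.span_eq
      rw [Submodule.map_span, Submodule.map_top, Submodule.range_subtype, ← Set.range_comp,
        b.coe_toBasis] at this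
      exact this
    have h2 := congrArg (Submodule.map e.toLinearMap) h1
    rw [Submodule.map_span, ← Set.range_comp, ← Submodule.map_comp] at h2
    rw [show e.toLinearMap ∘ₗ e.symm.toLinearMap = LinearMap.id by ext; simp,
      Submodule.map_id] at h2
    exact h2

lemma exists_orthonormal_factor {P : Matrix m m ℝ} (hP : P * P = P) (hPt : Pᵀ = P) :
    ∃ (k : ℕ) (Q : Matrix m (Fin k) ℝ), Qᵀ * Q = 1 ∧ Q * Qᵀ = P := by
  obtain ⟨k, Q, -, hQ, hr⟩ := exists_orthonormal_columns (LinearMap.range P.mulVecLin)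
  refine ⟨k, Q, hQ, ?_⟩
  have h1 : P * Q = Q := mul_eq_self_of_range_le hP hr.le
  have h2 : Q * Qᵀ * P = P := by
    refine mul_eq_self_of_range_le (mul_transpose_self_mul_self hQ) ?_
    rw [← hr]
    rintro _ ⟨c, rfl⟩
    refine ⟨Q *ᵥ c, ?_⟩
    rw [Matrix.mulVecLin_apply, Matrix.mulVecLin_apply, Matrix.mulVec_mulVec, Matrix.mul_assoc,
      hQ, Matrix.mul_one]
  have h3 : Qᵀ * P = Qᵀ := by
    rw [← Matrix.transpose_inj, Matrix.transpose_mul, hPt, Matrix.transpose_transpose, h1]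
  rw [← h2, Matrix.mul_assoc, h3]

/-- The right inverse of a matrix of full row rank. -/
def rightInv [DecidableEq q] (M : Matrix q l ℝ) : Matrix l q ℝ := Mᵀ * (M * Mᵀ)⁻¹

/-- `rightInv G * G` is an orthogonal projection that carries any right inverse `N` to `rightInv G`,
which therefore has least norm. -/
lemma norm_sq_rightInv_le [DecidableEq q] [DecidableEq l] {G : Matrix q l ℝ} {N : Matrix l q ℝ}
    (h : G * N = 1) : IsUnit (G * Gᵀ).det ∧ ‖rightInv G‖ ^ 2 ≤ ‖N‖ ^ 2 := by
  have hu : IsUnit (G * Gᵀ).det := by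
    rw [isUnit_iff_ne_zero]
    intro h0
    obtain ⟨x, hx, hGx⟩ := Matrix.exists_mulVec_eq_zero_iff.2 h0
    have h1 : Gᵀ *ᵥ x = 0 := by
      rw [← Matrix.mulVec_mulVec] at hGx
      rw [← dotProduct_self_eq_zero, Matrix.dotProduct_mulVec, Matrix.vecMul_transpose, hGx,
        zero_dotProduct]
    refine hx ?_
    have h2 : Nᵀ * Gᵀ = 1 := by rw [← Matrix.transpose_mul, h, Matrix.transpose_one]
    rw [← Matrix.one_mulVec x, ← h2, ← Matrix.mulVec_mulVec, h1, Matrix.mulVec_zero]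
  refine ⟨hu, ?_⟩
  have hsymm : (G * Gᵀ)⁻¹ᵀ = (G * Gᵀ)⁻¹ := by
    rw [Matrix.transpose_nonsing_inv, transpose_mul_transpose_self]
  have h1 : G * rightInv G = 1 := by
    rw [rightInv, ← Matrix.mul_assoc, Matrix.mul_nonsing_inv _ hu]
  have h2 : rightInv G * G * N = rightInv G := by rw [Matrix.mul_assoc, h, Matrix.mul_one]
  rw [← h2]
  gcongr
  refine norm_projection_mul_le ?_ ?_ _
  · rw [Matrix.mul_assoc, ← Matrix.mul_assoc G, h1, Matrix.one_mul]
  · rw [rightInv, Matrix.transpose_mul, Matrix.transpose_mul, hsymm, Matrix.transpose_transpose,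
      Matrix.mul_assoc]

/-- The residual `w i` of row `i` after projection onto the span of the other rows is orthogonal to
those rows and has inner product `‖w i‖²` with row `i`. The scaled vectors `w i / ‖w i‖²` thus form
a right inverse, with squared column norms `1/‖w i‖²`. Finiteness of the sum excludes zero
residuals. -/
lemma norm_sq_rightInv_le_invDistSum [DecidableEq q] {G : Matrix q l ℝ}
    (h : invDistSum G ≠ ⊤) :
    IsUnit (G * Gᵀ).det ∧ ENNReal.ofReal (‖rightInv G‖ ^ 2) ≤ invDistSum G := by
  classical
  let g : q → EuclideanSpace ℝ l := fun i => WithLp.toLp 2 (G i)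
  let K : q → Submodule ℝ (EuclideanSpace ℝ l) := fun i =>
    Submodule.span ℝ (Set.range fun j : {j // j ≠ i} => g j)
  let w : q → EuclideanSpace ℝ l := fun i => g i - (K i).starProjection (g i)
  have hw : ∀ i, rowDist G i = ‖w i‖ := fun i => infDist_submodule_eq_norm (K i) (g i)
  have hpos : ∀ i, 0 < ‖w i‖ ^ 2 := fun i => by
    have h1 := (ENNReal.sum_ne_top.1 h) i (Finset.mem_univ i)
    rw [hw, Ne, ENNReal.inv_eq_top, ENNReal.ofReal_eq_zero, not_le] at h1
    exact h1
  have hmem : ∀ i, w i ∈ (K i)ᗮ := fun i => Submodule.sub_starProjection_mem_orthogonal _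
  have hin : ∀ i j, inner ℝ (g j) (w i) = if j = i then ‖w i‖ ^ 2 else 0 := fun i j => by
    split_ifs with hij
    · subst hij
      have h1 : g j = w j + (K j).starProjection (g j) := by simp [w]
      rw [h1, inner_add_left, real_inner_self_eq_norm_sq, add_eq_left]
      exact (hmem j) _ (Submodule.starProjection_apply_mem _ _)
    · exact (hmem i) _ (Submodule.subset_span ⟨⟨j, hij⟩, rfl⟩)
  let N : Matrix l q ℝ := Matrix.of fun b i => (‖w i‖ ^ 2)⁻¹ * w i b
  have hGN : G * N = 1 := by
    ext j i
    have h1 := hin i j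
    rw [PiLp.inner_apply] at h1
    have h2 : (G * N) j i = (‖w i‖ ^ 2)⁻¹ * ∑ b, inner ℝ (g j b) (w i b) := by
      rw [Matrix.mul_apply, Finset.mul_sum]
      refine Finset.sum_congr rfl fun b _ => ?_
      simp [N, g]
      ring
    rw [h2, h1, Matrix.one_apply]
    split_ifs
    · exact inv_mul_cancel₀ (hpos i).ne'
    · rw [mul_zero]
  have hN : ‖N‖ ^ 2 = ∑ i, (rowDist G i ^ 2)⁻¹ := by
    rw [norm_sq_eq_sum, Finset.sum_comm]
    refine Finset.sum_congr rfl fun i _ => ?_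
    simp only [N, Matrix.of_apply, mul_pow, ← Finset.mul_sum]
    rw [← EuclideanSpace.real_norm_sq_eq, hw, pow_two, mul_assoc,
      inv_mul_cancel₀ (hpos i).ne', mul_one]
  obtain ⟨h1, h2⟩ := norm_sq_rightInv_le hGN
  refine ⟨h1, (ENNReal.ofReal_le_ofReal h2).trans ?_⟩
  rw [hN, ENNReal.ofReal_sum_of_nonneg fun i _ => by positivity]
  refine (Finset.sum_congr rfl fun i _ => ?_).le
  rw [ENNReal.ofReal_inv_of_pos (by rw [hw]; exact hpos i)]

end

end

end SketchyCGM

/-! ### Measurable matrix operations and independent Gaussian compressions -/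

namespace SketchyCGM

noncomputable section

/-- Measurability of all entries of a random matrix. -/
def EntrywiseMeasurable {Ω : Type*} [MeasurableSpace Ω] {m n : Type*} (F : Ω → Matrix m n ℝ) :
    Prop :=
  ∀ i j, Measurable fun ω => F ω i j

namespace EntrywiseMeasurable

variable {Ω : Type*} [MeasurableSpace Ω] {m n q : Type*} {F G : Ω → Matrix m n ℝ}

lemma const (A : Matrix m n ℝ) : EntrywiseMeasurable fun _ : Ω => A :=
  fun _ _ => measurable_const

lemma transpose (hF : EntrywiseMeasurable F) : EntrywiseMeasurable fun ω => (F ω)ᵀ :=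
  fun i j => hF j i

lemma add (hF : EntrywiseMeasurable F) (hG : EntrywiseMeasurable G) :
    EntrywiseMeasurable fun ω => F ω + G ω :=
  fun i j => (hF i j).add (hG i j)

lemma sub (hF : EntrywiseMeasurable F) (hG : EntrywiseMeasurable G) :
    EntrywiseMeasurable fun ω => F ω - G ω :=
  fun i j => (hF i j).sub (hG i j)

lemma mul [Fintype n] {H : Ω → Matrix n q ℝ} (hF : EntrywiseMeasurable F)
    (hH : EntrywiseMeasurable H) : EntrywiseMeasurable fun ω => F ω * H ω := fun i j => by
  simp only [Matrix.mul_apply]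
  exact Finset.measurable_sum _ fun k _ => (hF i k).mul (hH k j)

lemma det [Fintype q] [DecidableEq q] {H : Ω → Matrix q q ℝ} (hH : EntrywiseMeasurable H) :
    Measurable fun ω => (H ω).det := by
  simp only [Matrix.det_apply']
  exact Finset.measurable_sum _ fun σ _ =>
    (Finset.measurable_prod _ fun i _ => hH (σ i) i).const_mul _

lemma inv [Fintype q] [DecidableEq q] {H : Ω → Matrix q q ℝ} (hH : EntrywiseMeasurable H) :
    EntrywiseMeasurable fun ω => (H ω)⁻¹ := fun i j => by
  simp only [Matrix.inv_def, Matrix.smul_apply, smul_eq_mul, Ring.inverse_eq_inv',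
    Matrix.adjugate_apply]
  refine hH.det.inv.mul (det fun a b => ?_)
  by_cases h : a = j
  · subst h
    simp
  · simpa [h] using hH a b

lemma norm_sq [Fintype m] [Fintype n] (hF : EntrywiseMeasurable F) :
    Measurable fun ω => ‖F ω‖ ^ 2 := by
  simp only [norm_sq_eq_sum]
  exact Finset.measurable_sum _ fun i _ => Finset.measurable_sum _ fun j _ => (hF i j).pow_const 2

lemma rightInv [Fintype m] [Fintype n] [DecidableEq m] (hF : EntrywiseMeasurable F) :
    EntrywiseMeasurable fun ω => rightInv (F ω) :=
  hF.transpose.mul (hF.mul hF.transpose).inv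

lemma toMat {x : Ω → m × n → ℝ} (hx : Measurable x) :
    EntrywiseMeasurable fun ω => toMat (x ω) :=
  fun i j => (measurable_pi_apply (i, j)).comp hx

end EntrywiseMeasurable

section

variable {m n q l p : Type*} [Fintype m] [Fintype n] [Fintype q] [Fintype l] [Fintype p]

lemma lintegral_norm_mul_toMat_mul_sq (A : Matrix p q ℝ) (B : Matrix l n ℝ) :
    ∫⁻ y, ENNReal.ofReal (‖A * toMat y * B‖ ^ 2) ∂stdNormal (q × l) =
      ENNReal.ofReal (‖A‖ ^ 2 * ‖B‖ ^ 2) := by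
  have h1 : ∀ (y : q × l → ℝ) a b,
      (A * toMat y * B) a b = ∑ ij : q × l, (A a ij.1 * B ij.2 b) * y ij := fun y a b => by
    rw [Matrix.mul_apply, Fintype.sum_prod_type_right]
    refine Finset.sum_congr rfl fun j _ => ?_
    rw [Matrix.mul_apply, Finset.sum_mul]
    refine Finset.sum_congr rfl fun i _ => ?_
    simp only [toMat, Matrix.of_apply]
    ring
  have h2 : ∀ y : q × l → ℝ, ENNReal.ofReal (‖A * toMat y * B‖ ^ 2) =
      ∑ a, ∑ b, ENNReal.ofReal ((∑ ij : q × l, (A a ij.1 * B ij.2 b) * y ij) ^ 2) := fun y => by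
    rw [norm_sq_eq_sum, ENNReal.ofReal_sum_of_nonneg fun a _ => by positivity]
    refine Finset.sum_congr rfl fun a _ => ?_
    rw [ENNReal.ofReal_sum_of_nonneg fun b _ => by positivity]
    simp_rw [h1]
  have hm : ∀ a b, Measurable fun y : q × l → ℝ =>
      ENNReal.ofReal ((∑ ij : q × l, (A a ij.1 * B ij.2 b) * y ij) ^ 2) := fun a b => by
    fun_prop
  simp_rw [h2]
  rw [lintegral_finsetSum _ fun a _ => Finset.measurable_sum _ fun b _ => hm a b]
  simp_rw [lintegral_finsetSum _ fun b _ => hm _ b, lintegral_sq_sum_stdNormal]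
  have h3 : ∀ a b, 0 ≤ ∑ ij : q × l, (A a ij.1 * B ij.2 b) ^ 2 := fun a b => by positivity
  simp_rw [← ENNReal.ofReal_sum_of_nonneg fun b _ => h3 _ b]
  rw [← ENNReal.ofReal_sum_of_nonneg fun a _ => Finset.sum_nonneg fun b _ => h3 a b]
  congr 1
  rw [norm_sq_eq_sum A, norm_sq_eq_sum B, Finset.sum_mul]
  refine Finset.sum_congr rfl fun a _ => ?_
  rw [Finset.sum_comm, Fintype.sum_prod_type, Finset.sum_mul]
  refine Finset.sum_congr rfl fun i _ => ?_
  rw [Finset.mul_sum]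
  refine Finset.sum_congr rfl fun j _ => ?_
  rw [Finset.mul_sum]
  refine Finset.sum_congr rfl fun b _ => ?_
  ring

lemma dotProduct_uncurry (A B : Matrix m n ℝ) :
    (fun p : m × n => A p.1 p.2) ⬝ᵥ (fun p : m × n => B p.1 p.2) = (Aᵀ * B).trace := by
  rw [dotProduct, Fintype.sum_prod_type_right]
  simp [Matrix.trace, Matrix.mul_apply]

/-- The compressions of a standard normal matrix to complementary orthogonal subspaces are
independent standard normal matrices. -/
lemma measurePreserving_compressions [DecidableEq q] [DecidableEq p] {Q : Matrix m q ℝ}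
    {Q' : Matrix m p ℝ} (hQ : Qᵀ * Q = 1) (hQ' : Q'ᵀ * Q' = 1) (hQQ' : Qᵀ * Q' = 0) :
    MeasurePreserving (fun x : m × l → ℝ =>
        ((fun a : q × l => (Qᵀ * toMat x) a.1 a.2), (fun a : p × l => (Q'ᵀ * toMat x) a.1 a.2)))
      (stdNormal (m × l)) ((stdNormal (q × l)).prod (stdNormal (p × l))) := by
  have hQ'Q : Q'ᵀ * Q = 0 := by
    rw [← Matrix.transpose_inj, Matrix.transpose_mul, Matrix.transpose_transpose, hQQ',
      Matrix.transpose_zero]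
  let L : (m × l → ℝ) →ₗ[ℝ] ((q × l) ⊕ (p × l) → ℝ) :=
    { toFun := fun x => Sum.elim (fun a => (Qᵀ * toMat x) a.1 a.2)
        (fun a => (Q'ᵀ * toMat x) a.1 a.2)
      map_add' := fun x y => by
        have h : toMat (x + y) = toMat x + toMat y := rfl
        ext (a | a) <;> simp [h, Matrix.mul_add]
      map_smul' := fun c x => by
        have h : toMat (c • x) = c • toMat x := rfl
        ext (a | a) <;> simp [h] }
  -- `M` is the transpose of `L`; it is isometric because the columns of `Q` and `Q'` are jointly
  -- orthonormal.
  let M : ((q × l) ⊕ (p × l) → ℝ) → Matrix m l ℝ := fun y =>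
    Q * toMat (fun a => y (Sum.inl a)) + Q' * toMat (fun a => y (Sum.inr a))
  have hsplit : ∀ y z : (q × l) ⊕ (p × l) → ℝ, y ⬝ᵥ z =
      ((toMat fun a => y (Sum.inl a))ᵀ * toMat fun a => z (Sum.inl a)).trace +
      ((toMat fun a => y (Sum.inr a))ᵀ * toMat fun a => z (Sum.inr a)).trace := fun y z => by
    rw [← dotProduct_uncurry, ← dotProduct_uncurry, dotProduct, Fintype.sum_sum_type]
    rfl
  have hmp := measurePreserving_stdNormal L (fun y a => M y a.1 a.2)
    (fun x y => by
      have h1 : x = fun a : m × l => toMat x a.1 a.2 := rfl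
      rw [hsplit]
      conv_rhs => rw [h1]
      rw [dotProduct_uncurry, Matrix.mul_add, Matrix.trace_add]
      have h2 : toMat (fun a => L x (Sum.inl a)) = Qᵀ * toMat x := rfl
      have h3 : toMat (fun a => L x (Sum.inr a)) = Q'ᵀ * toMat x := rfl
      rw [h2, h3, Matrix.transpose_mul, Matrix.transpose_mul, Matrix.transpose_transpose,
        Matrix.transpose_transpose, Matrix.mul_assoc, Matrix.mul_assoc])
    (fun y => by
      rw [dotProduct_uncurry, ← norm_sq_eq_trace, norm_add_sq_of_transpose_mul_eq_zero,
        norm_mul_of_transpose_mul_self hQ, norm_mul_of_transpose_mul_self hQ', hsplit,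
        norm_sq_eq_trace, norm_sq_eq_trace]
      rw [Matrix.transpose_mul, Matrix.mul_assoc, ← Matrix.mul_assoc Qᵀ, hQQ', Matrix.zero_mul,
        Matrix.mul_zero])
  exact (measurePreserving_sumPiEquivProdPi
    (fun _ : (q × l) ⊕ (p × l) => gaussianReal 0 1)).comp hmp

/-- As `C` kills the columns of `Q`, the product `C * toMat x` depends only on the compression to
the orthogonal complement, which is independent of `G = Qᵀ * toMat x`. Averaging over it first
leaves `‖C‖² ‖rightInv G‖²`, and the last factor has mean at most `1`. The lemma serves both test
matrices. -/
lemma ae_isUnit_det_compression [DecidableEq m] [DecidableEq q] {Q : Matrix m q ℝ}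
    (hQ : Qᵀ * Q = 1)
    (hql : 2 * Fintype.card q + 1 ≤ Fintype.card l) {C : Matrix p m ℝ} (hC : C * Q = 0) :
    (∀ᵐ x ∂stdNormal (m × l), IsUnit (Qᵀ * toMat x * (Qᵀ * toMat x)ᵀ).det) ∧
    ∫⁻ x, ENNReal.ofReal (‖C * toMat x * rightInv (Qᵀ * toMat x)‖ ^ 2) ∂stdNormal (m × l) ≤
      ENNReal.ofReal (‖C‖ ^ 2) := by
  obtain ⟨k, Q', hQ', hQQ'⟩ := exists_orthonormal_factor (P := 1 - Q * Qᵀ)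
    (by
      rw [Matrix.sub_mul, Matrix.mul_sub, Matrix.mul_sub, mul_transpose_self_mul_self hQ]
      simp)
    (by rw [Matrix.transpose_sub, transpose_mul_transpose_self, Matrix.transpose_one])
  have hzero : Qᵀ * Q' = 0 := by
    have h1 : Qᵀ * (Q' * Q'ᵀ) = 0 := by
      rw [hQQ', Matrix.mul_sub, ← Matrix.mul_assoc, hQ]; simp
    rw [← Matrix.mul_one (Qᵀ * Q'), ← hQ', ← Matrix.mul_assoc, Matrix.mul_assoc Qᵀ, h1,
      Matrix.zero_mul]
  have hmp := measurePreserving_compressions (l := l) hQ hQ' hzero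
  have hinv := lintegral_invDistSum_le_one hql
  have hmeas : Measurable fun y : q × l → ℝ => invDistSum (toMat y) :=
    Finset.measurable_sum _ fun i _ => (((measurable_rowDist i).pow_const 2).ennreal_ofReal).inv
  have hae : ∀ᵐ y ∂stdNormal (q × l), invDistSum (toMat y) ≠ ⊤ :=
    (ae_lt_top hmeas (hinv.trans_lt ENNReal.one_lt_top).ne).mono fun y hy => hy.ne
  refine ⟨?_, ?_⟩
  · have hfst := (measurePreserving_fst (μ := stdNormal (q × l)) (ν := stdNormal (Fin k × l))).comp
      hmp
    filter_upwards [hfst.quasiMeasurePreserving.ae hae] with x hx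
    exact (norm_sq_rightInv_le_invDistSum hx).1
  · have hCQ : C * Q' * Q'ᵀ = C := by
      rw [Matrix.mul_assoc, hQQ', Matrix.mul_sub, ← Matrix.mul_assoc, hC]; simp
    have hf : Measurable fun y : (q × l → ℝ) × (Fin k × l → ℝ) =>
        ENNReal.ofReal (‖C * Q' * toMat y.2 * rightInv (toMat y.1)‖ ^ 2) :=
      ((((EntrywiseMeasurable.const (C * Q')).mul
        (EntrywiseMeasurable.toMat measurable_snd)).mul
        (EntrywiseMeasurable.toMat measurable_fst).rightInv).norm_sq).ennreal_ofReal
    have h1 := hmp.lintegral_comp hf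
    have h2 : ∀ x : m × l → ℝ,
        C * Q' * toMat (fun a : Fin k × l => (Q'ᵀ * toMat x) a.1 a.2) = C * toMat x := fun x => by
      change C * Q' * (Q'ᵀ * toMat x) = _
      rw [← Matrix.mul_assoc, hCQ]
    simp only [h2] at h1
    refine h1.le.trans ?_
    rw [lintegral_prod _ hf.aemeasurable]
    simp only [lintegral_norm_mul_toMat_mul_sq]
    have h3 : ‖C * Q'‖ = ‖C‖ := by
      rw [← norm_mul_transpose_of_transpose_mul_self hQ', hCQ]
    rw [h3]
    simp_rw [ENNReal.ofReal_mul (sq_nonneg ‖C‖)]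
    calc _ ≤ ∫⁻ y, ENNReal.ofReal (‖C‖ ^ 2) * invDistSum (toMat y) ∂stdNormal (q × l) := by
          refine lintegral_mono_ae (hae.mono fun y hy => ?_)
          gcongr
          exact (norm_sq_rightInv_le_invDistSum hy).2
      _ ≤ _ := by
          rw [lintegral_const_mul _ hmeas]
          exact mul_le_of_le_one_right' hinv

end

end

end SketchyCGM

/-! ### Measurable projections and deterministic error bounds -/

namespace SketchyCGM

noncomputable section

section

variable {m n k q l : Type*} [Fintype m] [Fintype n] [Fintype k] [Fintype q] [Fintype l]

lemma range_le_range_mul_transpose [DecidableEq q] {Q : Matrix m q ℝ} (hQ : Qᵀ * Q = 1) :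
    LinearMap.range Q.mulVecLin ≤ LinearMap.range (Q * Qᵀ).mulVecLin := by
  rintro _ ⟨c, rfl⟩
  refine ⟨Q *ᵥ c, ?_⟩
  rw [Matrix.mulVecLin_apply, Matrix.mulVecLin_apply, Matrix.mulVec_mulVec, Matrix.mul_assoc,
    hQ, Matrix.mul_one]

/-- The squared norm of a vector minus its squared distance to the range of a matrix. -/
def rangeForm (Y : Matrix m k ℝ) (x : m → ℝ) : ℝ :=
  x ⬝ᵥ x - Metric.infDist (WithLp.toLp 2 x) (Submodule.span ℝ
    (Set.range fun j => (WithLp.toLp 2 (Yᵀ j) : EuclideanSpace ℝ m)) : Set _) ^ 2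

/-- The orthogonal projection onto the range of a matrix. -/
def rangeProj [DecidableEq m] (Y : Matrix m k ℝ) : Matrix m m ℝ := Matrix.of fun i j =>
  -- Polarization recovers the projection from distances alone, which makes it measurable in `Y`
  -- without a choice of basis.
  (rangeForm Y (Pi.single i 1 + Pi.single j 1) - rangeForm Y (Pi.single i 1 - Pi.single j 1)) / 4

lemma EntrywiseMeasurable.rangeProj {Ω : Type*} [MeasurableSpace Ω] [DecidableEq m]
    {Y : Ω → Matrix m k ℝ} (hY : EntrywiseMeasurable Y) :
    EntrywiseMeasurable fun ω => rangeProj (Y ω) := by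
  have h : ∀ x, Measurable fun ω => rangeForm (Y ω) x := fun x => by
    refine measurable_const.sub ((measurable_infDist_span measurable_const fun j => ?_).pow_const 2)
    exact (WithLp.measurable_toLp 2 _).comp (measurable_pi_lambda _ fun i => hY i j)
  exact fun i j => ((h _).sub (h _)).div_const 4

lemma rangeForm_eq [DecidableEq q] {Y : Matrix m k ℝ} {Q : Matrix m q ℝ} (hQ : Qᵀ * Q = 1)
    (hr : LinearMap.range Q.mulVecLin = LinearMap.range Y.mulVecLin) (x : m → ℝ) :
    rangeForm Y x = x ⬝ᵥ (Q * Qᵀ) *ᵥ x := by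
  set K : Submodule ℝ (EuclideanSpace ℝ m) := Submodule.span ℝ
    (Set.range fun j => (WithLp.toLp 2 (Yᵀ j) : EuclideanSpace ℝ m)) with hK
  have hKmem : ∀ y : m → ℝ, WithLp.toLp 2 y ∈ K ↔ y ∈ LinearMap.range Q.mulVecLin := fun y => by
    have h1 : K = (LinearMap.range Q.mulVecLin).map
        (WithLp.linearEquiv 2 ℝ (m → ℝ)).symm.toLinearMap := by
      rw [hr, Matrix.range_mulVecLin, Submodule.map_span, ← Set.range_comp]
      rfl
    rw [h1]
    refine ⟨?_, fun h => ⟨y, h, rfl⟩⟩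
    rintro ⟨z, hz, hzy⟩
    rwa [← show z = y from congrArg WithLp.ofLp hzy]
  have hin : ∀ a b : m → ℝ, inner ℝ (WithLp.toLp 2 a) (WithLp.toLp 2 b) = a ⬝ᵥ b := fun a b => by
    rw [EuclideanSpace.inner_eq_star_dotProduct, star_trivial, dotProduct_comm]
  have hproj : K.starProjection (WithLp.toLp 2 x) = WithLp.toLp 2 ((Q * Qᵀ) *ᵥ x) := by
    refine Submodule.eq_starProjection_of_mem_of_inner_eq_zero ?_ ?_
    · rw [hKmem, ← Matrix.mulVec_mulVec]
      exact ⟨_, rfl⟩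
    · intro w hw
      obtain ⟨c, hc⟩ := (hKmem w.ofLp).1 hw
      rw [← WithLp.toLp_sub]
      refine (hin _ w.ofLp).trans ?_
      rw [← hc, Matrix.mulVecLin_apply, Matrix.dotProduct_mulVec, ← Matrix.mulVec_transpose,
        Matrix.mulVec_sub, Matrix.mulVec_mulVec, ← Matrix.mul_assoc, hQ, Matrix.one_mul, sub_self,
        zero_dotProduct]
  have hself : ((Q * Qᵀ) *ᵥ x) ⬝ᵥ ((Q * Qᵀ) *ᵥ x) = x ⬝ᵥ (Q * Qᵀ) *ᵥ x := by
    rw [Matrix.dotProduct_mulVec, ← Matrix.mulVec_transpose, transpose_mul_transpose_self,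
      Matrix.mulVec_mulVec, mul_transpose_self_mul_self hQ, dotProduct_comm]
  rw [rangeForm, ← hK, infDist_submodule_eq_norm, hproj, ← WithLp.toLp_sub,
    ← real_inner_self_eq_norm_sq, hin, sub_dotProduct, dotProduct_sub, dotProduct_sub, hself,
    dotProduct_comm ((Q * Qᵀ) *ᵥ x) x]
  ring

lemma rangeProj_eq [DecidableEq m] [DecidableEq q] {Y : Matrix m k ℝ} {Q : Matrix m q ℝ}
    (hQ : Qᵀ * Q = 1) (hr : LinearMap.range Q.mulVecLin = LinearMap.range Y.mulVecLin) :
    rangeProj Y = Q * Qᵀ := by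
  have hsymm : ∀ i j, (Q * Qᵀ) i j = (Q * Qᵀ) j i := fun i j =>
    congrFun (congrFun (transpose_mul_transpose_self Q) j) i
  ext i j
  rw [rangeProj, Matrix.of_apply, rangeForm_eq hQ hr, rangeForm_eq hQ hr]
  simp only [Matrix.mulVec_add, Matrix.mulVec_sub, add_dotProduct, sub_dotProduct, dotProduct_add,
    dotProduct_sub, Matrix.mulVec_single_one, single_one_dotProduct, Matrix.col_apply]
  rw [hsymm j i]
  ring

/-- The compression of `Ψᵀ Ψ` to the range of a projection `P`, completed by the identity on the
orthogonal complement. -/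
def compressedGram [DecidableEq m] (Psi : Matrix l m ℝ) (P : Matrix m m ℝ) : Matrix m m ℝ :=
  -- The summand `1 - P` keeps the size fixed as the rank of `P` varies, and the matrix is
  -- invertible exactly when `Psi` is injective on the range of `P`.
  P * (Psiᵀ * Psi) * P + (1 - P)

/-- The oblique projection `(Ψ P)† Ψ`. -/
def obliqueProj [DecidableEq m] (Psi : Matrix l m ℝ) (P : Matrix m m ℝ) : Matrix m m ℝ :=
  P * (compressedGram Psi P)⁻¹ * P * (Psiᵀ * Psi)

lemma transpose_mul_compressedGram [DecidableEq m] [DecidableEq q] {Q : Matrix m q ℝ}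
    (hQ : Qᵀ * Q = 1) (Psi : Matrix l m ℝ) :
    Qᵀ * compressedGram Psi (Q * Qᵀ) = Qᵀ * (Psiᵀ * Psi) * Q * Qᵀ := by
  have h : Qᵀ * (Q * Qᵀ) = Qᵀ := by rw [← Matrix.mul_assoc, hQ, Matrix.one_mul]
  rw [compressedGram, Matrix.mul_add, Matrix.mul_sub, h, Matrix.mul_one, sub_self, add_zero]
  simp only [← Matrix.mul_assoc, hQ, Matrix.one_mul]

lemma isUnit_det_compressedGram [DecidableEq m] [DecidableEq q] {Q : Matrix m q ℝ}
    (hQ : Qᵀ * Q = 1) {Psi : Matrix l m ℝ} (h : IsUnit (Qᵀ * (Psiᵀ * Psi) * Q).det) :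
    IsUnit (compressedGram Psi (Q * Qᵀ)).det := by
  set S := Qᵀ * (Psiᵀ * Psi) * Q with hS
  have hG : compressedGram Psi (Q * Qᵀ) = Q * (S * Qᵀ) + (1 - Q * Qᵀ) := by
    rw [compressedGram, hS]
    simp only [Matrix.mul_assoc]
  refine Matrix.isUnit_det_of_right_inverse (B := Q * S⁻¹ * Qᵀ + (1 - Q * Qᵀ)) ?_
  have h1 : Qᵀ * (Q * S⁻¹ * Qᵀ + (1 - Q * Qᵀ)) = S⁻¹ * Qᵀ := by
    rw [Matrix.mul_add, Matrix.mul_sub, ← Matrix.mul_assoc, ← Matrix.mul_assoc,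
      ← Matrix.mul_assoc, hQ]
    simp
  rw [hG, Matrix.add_mul, Matrix.mul_assoc Q (S * Qᵀ), Matrix.mul_assoc S, h1,
    ← Matrix.mul_assoc S, Matrix.mul_nonsing_inv _ h, Matrix.one_mul, Matrix.sub_mul,
    Matrix.one_mul, Matrix.mul_assoc Q Qᵀ, h1, ← Matrix.mul_assoc]
  abel

lemma isUnit_det_of_compressedGram [DecidableEq m] [DecidableEq q] {Q : Matrix m q ℝ}
    (hQ : Qᵀ * Q = 1) {Psi : Matrix l m ℝ} (h : IsUnit (compressedGram Psi (Q * Qᵀ)).det) :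
    IsUnit (Qᵀ * (Psiᵀ * Psi) * Q).det := by
  refine Matrix.isUnit_det_of_right_inverse
    (B := Qᵀ * (compressedGram Psi (Q * Qᵀ))⁻¹ * Q) ?_
  rw [← Matrix.mul_assoc, ← Matrix.mul_assoc, ← transpose_mul_compressedGram hQ,
    Matrix.mul_nonsing_inv_cancel_right _ _ h, hQ]

lemma obliqueProj_eq [DecidableEq m] [DecidableEq q] {Q : Matrix m q ℝ}
    (hQ : Qᵀ * Q = 1) {Psi : Matrix l m ℝ} (h : IsUnit (Qᵀ * (Psiᵀ * Psi) * Q).det) :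
    obliqueProj Psi (Q * Qᵀ) = Q * ((Qᵀ * (Psiᵀ * Psi) * Q)⁻¹ * (Qᵀ * (Psiᵀ * Psi))) := by
  have h1 : Qᵀ * (compressedGram Psi (Q * Qᵀ))⁻¹ = (Qᵀ * (Psiᵀ * Psi) * Q)⁻¹ * Qᵀ := by
    rw [← Matrix.mul_nonsing_inv_cancel_right _ ((Qᵀ * (Psiᵀ * Psi) * Q)⁻¹ * Qᵀ)
      (isUnit_det_compressedGram hQ h), Matrix.mul_assoc _ Qᵀ, transpose_mul_compressedGram hQ,
      ← Matrix.mul_assoc, Matrix.nonsing_inv_mul _ h, Matrix.one_mul]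
  rw [obliqueProj, Matrix.mul_assoc Q, h1]
  have h2 : Qᵀ * (Q * Qᵀ) = Qᵀ := by rw [← Matrix.mul_assoc, hQ, Matrix.one_mul]
  simp only [Matrix.mul_assoc]
  rw [← Matrix.mul_assoc Qᵀ Q, hQ, Matrix.one_mul]

/-- The error of the oblique projection. -/
lemma norm_sub_obliqueProj_mul_sq [DecidableEq m] [DecidableEq q] {Q : Matrix m q ℝ}
    (hQ : Qᵀ * Q = 1) {Psi : Matrix l m ℝ} (h : IsUnit (Qᵀ * (Psiᵀ * Psi) * Q).det)
    (X : Matrix m n ℝ) :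
    ‖X - obliqueProj Psi (Q * Qᵀ) * X‖ ^ 2 = ‖(1 - Q * Qᵀ) * X‖ ^ 2 +
      ‖Xᵀ * (1 - Q * Qᵀ) * Psiᵀ * rightInv (Qᵀ * Psiᵀ)‖ ^ 2 := by
  set S := Qᵀ * (Psiᵀ * Psi) * Q with hS
  have hSt : S⁻¹ᵀ = S⁻¹ := by
    rw [Matrix.transpose_nonsing_inv, hS]
    simp [Matrix.mul_assoc]
  have h1 : (Xᵀ * (1 - Q * Qᵀ) * Psiᵀ * rightInv (Qᵀ * Psiᵀ))ᵀ =
      S⁻¹ * (Qᵀ * (Psiᵀ * Psi)) * ((1 - Q * Qᵀ) * X) := by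
    have h2 : Qᵀ * Psiᵀ * (Qᵀ * Psiᵀ)ᵀ = S := by
      rw [hS]; simp [Matrix.mul_assoc]
    rw [rightInv, h2]
    simp only [Matrix.transpose_mul, Matrix.transpose_transpose, Matrix.transpose_sub,
      Matrix.transpose_one, hSt, Matrix.mul_assoc]
  have h3 : S⁻¹ * (Qᵀ * (Psiᵀ * Psi)) * (Q * Qᵀ * X) = Qᵀ * X := by
    have : S⁻¹ * (Qᵀ * (Psiᵀ * Psi)) * (Q * Qᵀ * X) = S⁻¹ * S * (Qᵀ * X) := by
      rw [hS]; simp only [Matrix.mul_assoc]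
    rw [this, Matrix.nonsing_inv_mul _ h, Matrix.one_mul]
  rw [← Matrix.frobenius_norm_transpose (Xᵀ * _ * _ * _), h1, obliqueProj_eq hQ h, ← hS]
  -- The oblique projection fixes the range of `Q`, so its error is `(1 - Q * Qᵀ) * X` plus a term
  -- in that range.
  have h4 : X - Q * (S⁻¹ * (Qᵀ * (Psiᵀ * Psi))) * X = (1 - Q * Qᵀ) * X +
      Q * (-(S⁻¹ * (Qᵀ * (Psiᵀ * Psi)) * ((1 - Q * Qᵀ) * X))) := by
    have h5 : (1 - Q * Qᵀ) * X = X - Q * Qᵀ * X := by rw [Matrix.sub_mul, Matrix.one_mul]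
    rw [h5, Matrix.mul_sub, h3, neg_sub, Matrix.mul_sub]
    simp only [Matrix.mul_assoc]
    abel
  rw [h4, norm_add_sq_of_transpose_mul_eq_zero, norm_mul_of_transpose_mul_self hQ, norm_neg]
  rw [Matrix.transpose_mul, ← Matrix.mul_assoc, Matrix.mul_assoc Xᵀ, Matrix.transpose_sub,
    Matrix.transpose_one, transpose_mul_transpose_self, Matrix.sub_mul, Matrix.mul_assoc Q, hQ]
  simp

/-- The deterministic error bound for the projection onto the range of a sketch. -/
lemma norm_one_sub_mul_sq_le [DecidableEq m] [DecidableEq n] [DecidableEq q] {P : Matrix m m ℝ}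
    (hP : P * P = P) (hPt : Pᵀ = P) {X : Matrix m n ℝ} {Om : Matrix n k ℝ}
    (hPX : P * (X * Om) = X * Om) {V : Matrix n q ℝ} (hV : Vᵀ * V = 1)
    (h : IsUnit (Vᵀ * Om * (Vᵀ * Om)ᵀ).det) :
    ‖(1 - P) * X‖ ^ 2 ≤ ‖X * (1 - V * Vᵀ)‖ ^ 2 +
      ‖X * (1 - V * Vᵀ) * Om * rightInv (Vᵀ * Om)‖ ^ 2 := by
  set C := X * (1 - V * Vᵀ) with hC
  have hX : X = X * V * Vᵀ + C := by
    rw [hC, Matrix.mul_sub, Matrix.mul_one, Matrix.mul_assoc]; abel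
  have hright : Vᵀ * Om * rightInv (Vᵀ * Om) = 1 := by
    rw [rightInv, ← Matrix.mul_assoc, Matrix.mul_nonsing_inv _ h]
  have hP' : (1 - P) * (1 - P) = 1 - P := by
    rw [Matrix.sub_mul, Matrix.mul_sub, Matrix.mul_sub, hP]; simp
  have hPt' : (1 - P)ᵀ = 1 - P := by rw [Matrix.transpose_sub, hPt, Matrix.transpose_one]
  -- `1 - P` kills `X * Om`. Multiplying `X * Om = X * V * (Vᵀ * Om) + C * Om` on the right by
  -- `rightInv (Vᵀ * Om)` expresses `X * V` through `C` modulo the range of `P`.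
  have h1 : (1 - P) * (X * V) = -((1 - P) * (C * Om * rightInv (Vᵀ * Om))) := by
    rw [eq_neg_iff_add_eq_zero, ← Matrix.mul_add]
    have h2 : X * V + C * Om * rightInv (Vᵀ * Om) = X * Om * rightInv (Vᵀ * Om) := by
      conv_rhs => rw [hX, Matrix.add_mul, Matrix.add_mul]
      rw [Matrix.mul_assoc (X * V), Matrix.mul_assoc (X * V), hright, Matrix.mul_one]
    rw [h2, ← Matrix.mul_assoc, Matrix.sub_mul, Matrix.one_mul, hPX, sub_self, Matrix.zero_mul]
  have hCV : C * V = 0 := by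
    rw [hC, Matrix.mul_assoc, Matrix.sub_mul, Matrix.mul_assoc V, hV]; simp
  have h3 : ‖(1 - P) * X‖ ^ 2 = ‖(1 - P) * (X * V)‖ ^ 2 + ‖(1 - P) * C‖ ^ 2 := by
    conv_lhs => rw [hX, Matrix.mul_add, ← Matrix.mul_assoc]
    rw [norm_add_sq_of_mul_transpose_eq_zero, norm_mul_transpose_of_transpose_mul_self hV]
    have h4 : Vᵀ * Cᵀ = 0 := by rw [← Matrix.transpose_mul, hCV, Matrix.transpose_zero]
    rw [Matrix.transpose_mul, ← Matrix.mul_assoc, Matrix.mul_assoc _ Vᵀ, h4]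
    simp
  rw [h3, h1, norm_neg, add_comm]
  gcongr
  · exact norm_projection_mul_le hP' hPt' _
  · exact norm_projection_mul_le hP' hPt' _

end

/-- The error of the reconstruction is at most twice that of the oblique projection. -/
lemma norm_reconstruction_sub_le {m n k l : ℕ} {r : ℕ} {Psi : Matrix (Fin l) (Fin m) ℝ}
    {Y : Matrix (Fin m) (Fin k) ℝ} {X Xhat Xstar : Matrix (Fin m) (Fin n) ℝ}
    (hrec : IsReconstruction r Psi Y (Psi * X) Xhat) (hrank : Xstar.rank ≤ r)
    (hdet : IsUnit (compressedGram Psi (rangeProj Y)).det) :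
    ‖Xhat - Xstar‖ ≤ 2 * ‖obliqueProj Psi (rangeProj Y) * X - Xstar‖ := by
  obtain ⟨q, Q, N, B', hQ, hr, hN, ⟨-, hB'⟩, rfl⟩ := hrec
  rw [rangeProj_eq hQ hr] at hdet ⊢
  have hS := isUnit_det_of_compressedGram hQ hdet
  have hNeq : N = (Qᵀ * (Psiᵀ * Psi) * Q)⁻¹ * (Qᵀ * Psiᵀ) := by
    obtain ⟨h1, -, h3, -⟩ := hN
    -- The first and third Penrose equations for `M = Psi * Q` give the normal equations `Mᵀ M N =
    -- Mᵀ`.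
    have h4 : Qᵀ * (Psiᵀ * Psi) * Q * N = Qᵀ * Psiᵀ := by
      have := congrArg Matrix.transpose h1
      rw [Matrix.transpose_mul, h3] at this
      simpa [Matrix.mul_assoc] using this
    rw [← h4, ← Matrix.mul_assoc, Matrix.nonsing_inv_mul _ hS, Matrix.one_mul]
  have hB : Q * (N * (Psi * X)) = obliqueProj Psi (Q * Qᵀ) * X := by
    rw [obliqueProj_eq hQ hS, hNeq]
    simp only [Matrix.mul_assoc]
  rw [← hB]
  set B := N * (Psi * X)
  have h1 : ‖Q * B' - Q * B‖ ≤ ‖Q * B - Xstar‖ := by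
    rw [← Matrix.mul_sub, norm_mul_of_transpose_mul_self hQ, norm_sub_rev]
    -- `Qᵀ * Xstar` has rank at most `r`, so it competes with the truncation `B'`.
    refine (hB' (Qᵀ * Xstar) ((Matrix.rank_mul_le_right _ _).trans hrank)).trans ?_
    have h2 : B - Qᵀ * Xstar = Qᵀ * (Q * B - Xstar) := by
      rw [Matrix.mul_sub, ← Matrix.mul_assoc, hQ, Matrix.one_mul]
    rw [h2, ← norm_mul_of_transpose_mul_self hQ, ← Matrix.mul_assoc]
    exact norm_projection_mul_le (mul_transpose_self_mul_self hQ)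
      (transpose_mul_transpose_self Q) _
  have h3 := norm_add_le (Q * B' - Q * B) (Q * B - Xstar)
  rw [sub_add_sub_cancel] at h3
  linarith

end

end SketchyCGM

/-! ### Expected error of the sketch -/

namespace SketchyCGM

noncomputable section

section

variable {m n k q l : Type*} [Fintype m] [Fintype n] [Fintype k] [Fintype q] [Fintype l]

lemma measurePreserving_swap :
    MeasurePreserving (fun (y : l × m → ℝ) (a : m × l) => y a.swap) (stdNormal (l × m))
      (stdNormal (m × l)) :=
  measurePreserving_stdNormal (LinearMap.funLeft ℝ ℝ Prod.swap) (fun y a => y a.swap)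
    (fun x y => by
      rw [dotProduct, dotProduct, ← (Equiv.prodComm l m).sum_comp]
      rfl)
    (fun y => by
      rw [dotProduct, dotProduct, ← (Equiv.prodComm l m).sum_comp]
      rfl)

/-- The squared error of the oblique projection `(Ψ P)† Ψ`, infinite if `Ψ` is not injective on
the range of `P`. -/
def sketchError [DecidableEq m] (X : Matrix m n ℝ) (P : Matrix m m ℝ) (Psi : Matrix l m ℝ) :
    ℝ≥0∞ :=
  if (compressedGram Psi P).det = 0 then ⊤ else
    ENNReal.ofReal (‖X - obliqueProj Psi P * X‖ ^ 2)

lemma measurable_sketchError {Ω : Type*} [MeasurableSpace Ω] [DecidableEq m] (X : Matrix m n ℝ)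
    {P : Ω → Matrix m m ℝ} {Psi : Ω → Matrix l m ℝ} (hP : EntrywiseMeasurable P)
    (hPsi : EntrywiseMeasurable Psi) : Measurable fun ω => sketchError X (P ω) (Psi ω) := by
  have hG : EntrywiseMeasurable fun ω => compressedGram (Psi ω) (P ω) :=
    ((hP.mul (hPsi.transpose.mul hPsi)).mul hP).add ((EntrywiseMeasurable.const 1).sub hP)
  have hT : EntrywiseMeasurable fun ω => obliqueProj (Psi ω) (P ω) :=
    ((hP.mul hG.inv).mul hP).mul (hPsi.transpose.mul hPsi)
  exact Measurable.ite (hG.det (measurableSet_singleton 0)) measurable_const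
    ((EntrywiseMeasurable.const X).sub
      (hT.mul (EntrywiseMeasurable.const X))).norm_sq.ennreal_ofReal

/-- The expected squared error of the oblique projection. -/
lemma lintegral_sketchError_le [DecidableEq m] [DecidableEq q] {Q : Matrix m q ℝ}
    (hQ : Qᵀ * Q = 1) (hql : 2 * Fintype.card q + 1 ≤ Fintype.card l) (X : Matrix m n ℝ) :
    ∫⁻ y, sketchError X (Q * Qᵀ) (toMat y) ∂stdNormal (l × m) ≤
      2 * ENNReal.ofReal (‖(1 - Q * Qᵀ) * X‖ ^ 2) := by
  have hC : Xᵀ * (1 - Q * Qᵀ) * Q = 0 := by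
    rw [Matrix.mul_assoc, Matrix.sub_mul, Matrix.mul_assoc Q, hQ]; simp
  obtain ⟨hae, hle⟩ := ae_isUnit_det_compression hQ hql hC
  have hswap := measurePreserving_swap (m := m) (l := l)
  have hmeas : Measurable fun x : m × l → ℝ => ENNReal.ofReal
      (‖Xᵀ * (1 - Q * Qᵀ) * toMat x * rightInv (Qᵀ * toMat x)‖ ^ 2) :=
    ((((EntrywiseMeasurable.const _).mul (EntrywiseMeasurable.toMat measurable_id)).mul
      ((EntrywiseMeasurable.const _).mul
        (EntrywiseMeasurable.toMat measurable_id)).rightInv).norm_sq).ennreal_ofReal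
  rw [← hswap.lintegral_comp hmeas] at hle
  have hnorm : ‖Xᵀ * (1 - Q * Qᵀ)‖ = ‖(1 - Q * Qᵀ) * X‖ := by
    rw [← Matrix.frobenius_norm_transpose, Matrix.transpose_mul, Matrix.transpose_transpose,
      Matrix.transpose_sub, Matrix.transpose_one, transpose_mul_transpose_self]
  rw [hnorm] at hle
  have heq : ∀ᵐ y ∂stdNormal (l × m), sketchError X (Q * Qᵀ) (toMat y) =
      ENNReal.ofReal (‖(1 - Q * Qᵀ) * X‖ ^ 2) + ENNReal.ofReal
        (‖Xᵀ * (1 - Q * Qᵀ) * (toMat y)ᵀ * rightInv (Qᵀ * (toMat y)ᵀ)‖ ^ 2) := by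
    filter_upwards [hswap.quasiMeasurePreserving.ae hae] with y hy
    change IsUnit (Qᵀ * (toMat y)ᵀ * (Qᵀ * (toMat y)ᵀ)ᵀ).det at hy
    have hS : IsUnit (Qᵀ * ((toMat y)ᵀ * toMat y) * Q).det := by
      simpa [Matrix.mul_assoc] using hy
    rw [sketchError, if_neg (isUnit_det_compressedGram hQ hS).ne_zero,
      norm_sub_obliqueProj_mul_sq hQ hS, ENNReal.ofReal_add (sq_nonneg _) (sq_nonneg _)]
  rw [lintegral_congr_ae heq, lintegral_add_left measurable_const, lintegral_const, measure_univ,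
    mul_one, two_mul]
  gcongr
  exact hle

/-- The expected squared error of the projection onto the range of the sketch. -/
lemma lintegral_norm_one_sub_rangeProj_mul_sq_le [DecidableEq m] [DecidableEq n]
    {X Xstar : Matrix m n ℝ} (hk : 2 * Xstar.rank + 1 ≤ Fintype.card k) :
    ∫⁻ x, ENNReal.ofReal (‖(1 - rangeProj (X * toMat x)) * X‖ ^ 2) ∂stdNormal (n × k) ≤
      2 * ENNReal.ofReal (‖X - Xstar‖ ^ 2) := by
  -- `V` spans the row space of `Xstar`, not of `X`. So `1 - V * Vᵀ` kills `Xstar` from the right,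
  -- and `‖C‖` is at most `‖X - Xstar‖`.
  obtain ⟨s, V, hs, hV, hr⟩ := exists_orthonormal_columns (LinearMap.range Xstarᵀ.mulVecLin)
  have hs' : s = Xstar.rank := by rw [hs, ← Matrix.rank_transpose]; rfl
  have hXV : Xstar * (V * Vᵀ) = Xstar := by
    have h := mul_eq_self_of_range_le (mul_transpose_self_mul_self hV)
      (hr.ge.trans (range_le_range_mul_transpose hV))
    rw [← Matrix.transpose_inj, Matrix.transpose_mul, transpose_mul_transpose_self, h]
  set C := X * (1 - V * Vᵀ) with hCdef
  have hCV : C * V = 0 := by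
    rw [hCdef, Matrix.mul_assoc, Matrix.sub_mul, Matrix.mul_assoc V, hV]; simp
  have hVV : (1 - V * Vᵀ) * (1 - V * Vᵀ) = 1 - V * Vᵀ := by
    rw [Matrix.sub_mul, Matrix.mul_sub, Matrix.mul_sub, mul_transpose_self_mul_self hV]; simp
  have hC : ‖C‖ ≤ ‖X - Xstar‖ := by
    have h : C = (X - Xstar) * (1 - V * Vᵀ) := by
      rw [Matrix.sub_mul, Matrix.mul_sub Xstar, hXV]; simp [hCdef]
    rw [h]
    exact norm_mul_projection_le hVV
      (by rw [Matrix.transpose_sub, transpose_mul_transpose_self, Matrix.transpose_one]) _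
  obtain ⟨hae, hle⟩ := ae_isUnit_det_compression (l := k) hV (by rwa [Fintype.card_fin, hs']) hCV
  have hbound : ∀ᵐ x ∂stdNormal (n × k),
      ENNReal.ofReal (‖(1 - rangeProj (X * toMat x)) * X‖ ^ 2) ≤
        ENNReal.ofReal (‖C‖ ^ 2) +
          ENNReal.ofReal (‖C * toMat x * rightInv (Vᵀ * toMat x)‖ ^ 2) := by
    filter_upwards [hae] with x hx
    obtain ⟨_, Q, -, hQ, hQr⟩ :=
      exists_orthonormal_columns (LinearMap.range (X * toMat x).mulVecLin)
    rw [← ENNReal.ofReal_add (sq_nonneg _) (sq_nonneg _), rangeProj_eq hQ hQr]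
    refine ENNReal.ofReal_le_ofReal (norm_one_sub_mul_sq_le (mul_transpose_self_mul_self hQ)
      (transpose_mul_transpose_self Q) ?_ hV hx)
    exact mul_eq_self_of_range_le (mul_transpose_self_mul_self hQ)
      (hQr.ge.trans (range_le_range_mul_transpose hQ))
  refine (lintegral_mono_ae hbound).trans ?_
  rw [lintegral_add_left measurable_const, lintegral_const, measure_univ, mul_one, two_mul]
  have h2 : ENNReal.ofReal (‖C‖ ^ 2) ≤ ENNReal.ofReal (‖X - Xstar‖ ^ 2) := by gcongr
  exact add_le_add h2 (hle.trans h2)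

end

/-- For a fixed first test matrix the projection is fixed, of rank at most `k`, and the second one
is independent of it. Each of the two averages costs a factor `2`. -/
lemma lintegral_prod_sketchError_le {m n k l : ℕ} {X Xstar : Matrix (Fin m) (Fin n) ℝ}
    (hk : 2 * Xstar.rank + 1 ≤ k) (hl : 2 * k + 1 ≤ l) :
    ∫⁻ z, sketchError X (rangeProj (X * toMat z.1)) (toMat z.2)
      ∂(stdNormal (Fin n × Fin k)).prod (stdNormal (Fin l × Fin m)) ≤
      4 * ENNReal.ofReal (‖X - Xstar‖ ^ 2) := by
  refine (lintegral_prod_le _).trans ?_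
  have h : ∀ x : Fin n × Fin k → ℝ,
      ∫⁻ y, sketchError X (rangeProj (X * toMat x)) (toMat y) ∂stdNormal (Fin l × Fin m) ≤
        2 * ENNReal.ofReal (‖(1 - rangeProj (X * toMat x)) * X‖ ^ 2) := fun x => by
    obtain ⟨q, Q, hq, hQ, hQr⟩ :=
      exists_orthonormal_columns (LinearMap.range (X * toMat x).mulVecLin)
    have hqk : q ≤ k := by
      rw [hq]
      exact Matrix.rank_le_width (X * toMat x)
    rw [rangeProj_eq hQ hQr]
    exact lintegral_sketchError_le hQ (by simp only [Fintype.card_fin]; omega) X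
  refine (lintegral_mono h).trans ?_
  rw [lintegral_const_mul' _ _ ENNReal.ofNat_ne_top]
  calc _ ≤ 2 * (2 * ENNReal.ofReal (‖X - Xstar‖ ^ 2)) := by
        gcongr
        exact lintegral_norm_one_sub_rangeProj_mul_sq_le (by rwa [Fintype.card_fin])
    _ = _ := by rw [← mul_assoc]; norm_num

/-- The joint law of the test matrices. -/
lemma IndepStdNormal.hasLaw {Ω : Type*} [MeasurableSpace Ω] {P : Measure Ω}
    [IsProbabilityMeasure P] {m n k l : ℕ} {Om : Ω → Matrix (Fin n) (Fin k) ℝ}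
    {Psi : Ω → Matrix (Fin l) (Fin m) ℝ} (h : IndepStdNormal P Om Psi) :
    HasLaw (fun ω => ((fun p : Fin n × Fin k => Om ω p.1 p.2),
        (fun p : Fin l × Fin m => Psi ω p.1 p.2)))
      ((stdNormal (Fin n × Fin k)).prod (stdNormal (Fin l × Fin m))) P := by
  obtain ⟨h1, h2, h3⟩ := h
  set Z := Sum.elim (fun (p : Fin n × Fin k) (ω : Ω) => Om ω p.1 p.2)
    (fun (p : Fin l × Fin m) (ω : Ω) => Psi ω p.1 p.2) with hZ
  have hlaw : ∀ i, HasLaw (Z i) (gaussianReal 0 1) P := by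
    rintro (p | p)
    · exact h1 p.1 p.2
    · exact h2 p.1 p.2
  have hmap := (iIndepFun_iff_map_fun_eq_pi_map fun i => (hlaw i).aemeasurable).1 h3
  simp_rw [fun i => (hlaw i).map_eq] at hmap
  have hpi : HasLaw (fun ω i => Z i ω) (stdNormal ((Fin n × Fin k) ⊕ (Fin l × Fin m))) P :=
    ⟨aemeasurable_pi_lambda _ fun i => (hlaw i).aemeasurable, hmap⟩
  have hmp := measurePreserving_sumPiEquivProdPi
    (fun _ : (Fin n × Fin k) ⊕ (Fin l × Fin m) => gaussianReal 0 1)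
  exact HasLaw.comp ⟨hmp.measurable.aemeasurable, hmp.map_eq⟩ hpi

/-- Jensen's inequality, in the form that the `L¹` norm of `√g` is at most its `L²` norm on a
probability space. -/
lemma lintegral_rpow_half_le {Ω : Type*} [MeasurableSpace Ω] {P : Measure Ω}
    [IsProbabilityMeasure P] {g : Ω → ℝ≥0∞} (hg : AEMeasurable g P) :
    ∫⁻ ω, g ω ^ (1 / 2 : ℝ) ∂P ≤ (∫⁻ ω, g ω ∂P) ^ (1 / 2 : ℝ) := by
  have h := eLpNorm'_le_eLpNorm'_of_exponent_le (f := fun ω => g ω ^ (1 / 2 : ℝ)) one_pos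
    one_le_two P (hg.pow_const _).aestronglyMeasurable
  simp only [eLpNorm', enorm_eq_self, ENNReal.rpow_one, div_one, ← ENNReal.rpow_mul] at h
  norm_num at h ⊢
  exact h

end

end SketchyCGM

/-! ### The main theorem -/

theorem theorem4 {m n d : ℕ} (r : ℕ)
    -- the problem: minimize `f (𝒜 X)` subject to `‖X‖_{S₁} ≤ α`
    (α : ℝ) (hα : 0 ≤ α)
    (A : Fin d → Matrix (Fin m) (Fin n) ℝ)
    (f : EuclideanSpace ℝ (Fin d) → ℝ)
    (hfconv : ConvexOn ℝ Set.univ f) (hfdiff : ContDiff ℝ 1 f)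
    -- the solution and the growth condition
    (κ ν : ℝ) (hκ : 0 < κ) (hν : 0 < ν)
    (Xstar : Matrix (Fin m) (Fin n) ℝ)
    (hsol : SketchyCGM.IsSolution α A f Xstar)
    (hrank : Xstar.rank ≤ r)
    (hgrowth : ∀ X : Matrix (Fin m) (Fin n) ℝ, SketchyCGM.Feasible α X →
      κ * ‖X - Xstar‖ ^ ν ≤ f (SketchyCGM.linMap A X) - f (SketchyCGM.linMap A Xstar))
    -- the singular vectors computed along the iteration
    (u : ℕ → Fin m → ℝ) (v : ℕ → Fin n → ℝ)
    (huv : ∀ t, SketchyCGM.IsMaxSingVec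
      (SketchyCGM.linMapAdj A (gradient f (SketchyCGM.dualIterate α A u v t))) (u t) (v t))
    -- the random test matrices
    {Ω : Type*} [MeasurableSpace Ω] (P : Measure Ω) [IsProbabilityMeasure P]
    (Om : Ω → Matrix (Fin n) (Fin (2 * r + 1)) ℝ)
    (Psi : Ω → Matrix (Fin (4 * r + 3)) (Fin m) ℝ)
    (hnormal : SketchyCGM.IndepStdNormal P Om Psi)
    -- the reconstructions from the sketches
    (Xhat : ℕ → Ω → Matrix (Fin m) (Fin n) ℝ)
    (hmeas : ∀ t i j, AEMeasurable (fun ω => Xhat t ω i j) P)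
    (hrec : ∀ t, ∀ᵐ ω ∂P, SketchyCGM.IsReconstruction r (Psi ω)
      (SketchyCGM.rangeSketch α u v (Om ω) t) (SketchyCGM.corangeSketch α u v (Psi ω) t)
      (Xhat t ω)) :
    ∀ t : ℕ, 1 ≤ t →
      Integrable (fun ω => ‖Xhat t ω - Xstar‖) P ∧
      ENNReal.ofReal (∫ ω, ‖Xhat t ω - Xstar‖ ∂P) ≤
        6 * (2 * SketchyCGM.curvature α A f / ENNReal.ofReal κ / ((t : ℝ≥0∞) + 2)) ^ (1 / ν) := by
  intro t ht
  set X := SketchyCGM.primalIterate α u v t with hX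
  set τ := ‖X - Xstar‖ with hτ
  have hrate : ENNReal.ofReal τ ≤ _ :=
    SketchyCGM.ofReal_norm_primalIterate_sub_le hα hfconv hfdiff hκ hν hsol.1 hgrowth huv ht
  have hlaw := hnormal.hasLaw
  set E : (Fin n × Fin (2 * r + 1) → ℝ) × (Fin (4 * r + 3) × Fin m → ℝ) → ℝ≥0∞ := fun z =>
    SketchyCGM.sketchError X (SketchyCGM.rangeProj (X * SketchyCGM.toMat z.1))
      (SketchyCGM.toMat z.2) with hE
  have hEmeas : Measurable E := SketchyCGM.measurable_sketchError X
    ((SketchyCGM.EntrywiseMeasurable.const X).mul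
      (SketchyCGM.EntrywiseMeasurable.toMat measurable_fst)).rangeProj
    (SketchyCGM.EntrywiseMeasurable.toMat measurable_snd)
  set g : Ω → ℝ≥0∞ := fun ω => E ((fun p => Om ω p.1 p.2), (fun p => Psi ω p.1 p.2)) with hg
  have hgmeas : AEMeasurable g P := hEmeas.comp_aemeasurable hlaw.aemeasurable
  have hgint : ∫⁻ ω, g ω ∂P ≤ 4 * ENNReal.ofReal (τ ^ 2) := by
    have h := hlaw.lintegral_comp hEmeas.aemeasurable
    rw [← hg] at h
    rw [h]
    exact SketchyCGM.lintegral_prod_sketchError_le (by omega) (by omega)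
  -- Where the compressed Gram matrix is singular, `g ω = ⊤` and the bound is trivial. Elsewhere the
  -- factor `2` is the cost of truncation.
  have hpoint : ∀ᵐ ω ∂P, ENNReal.ofReal ‖Xhat t ω - Xstar‖ ≤
      2 * (g ω ^ (1 / 2 : ℝ) + ENNReal.ofReal τ) := by
    filter_upwards [hrec t] with ω hω
    rw [SketchyCGM.rangeSketch_eq, SketchyCGM.corangeSketch_eq, ← hX] at hω
    by_cases hdet : (SketchyCGM.compressedGram (Psi ω)
        (SketchyCGM.rangeProj (X * Om ω))).det = 0
    · have : g ω = ⊤ := if_pos hdet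
      simp [this]
    · have hgω : g ω = ENNReal.ofReal (‖X - SketchyCGM.obliqueProj (Psi ω)
          (SketchyCGM.rangeProj (X * Om ω)) * X‖ ^ 2) := if_neg hdet
      have h1 := SketchyCGM.norm_reconstruction_sub_le hω hrank (isUnit_iff_ne_zero.2 hdet)
      set T := SketchyCGM.obliqueProj (Psi ω) (SketchyCGM.rangeProj (X * Om ω)) * X
      have h2 : ‖T - Xstar‖ ≤ ‖X - T‖ + τ := by
        have h3 := norm_add_le (T - X) (X - Xstar)
        rwa [sub_add_sub_cancel, norm_sub_rev T X] at h3
      have h4 : g ω ^ (1 / 2 : ℝ) = ENNReal.ofReal ‖X - T‖ := by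
        rw [hgω, ENNReal.ofReal_rpow_of_nonneg (sq_nonneg _) (by norm_num), ← Real.sqrt_eq_rpow,
          Real.sqrt_sq (norm_nonneg _)]
      rw [h4, ← ENNReal.ofReal_add (norm_nonneg _) (norm_nonneg _), ← ENNReal.ofReal_ofNat,
        ← ENNReal.ofReal_mul (by norm_num)]
      exact ENNReal.ofReal_le_ofReal (by simpa using h1.trans (by linarith))
  have hmain : ∫⁻ ω, ENNReal.ofReal ‖Xhat t ω - Xstar‖ ∂P ≤ 6 * ENNReal.ofReal τ := by
    refine (lintegral_mono_ae hpoint).trans ?_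
    rw [lintegral_const_mul' _ _ ENNReal.ofNat_ne_top, lintegral_add_right _ measurable_const,
      lintegral_const, measure_univ, mul_one]
    have h1 : ∫⁻ ω, g ω ^ (1 / 2 : ℝ) ∂P ≤ 2 * ENNReal.ofReal τ := by
      refine (SketchyCGM.lintegral_rpow_half_le hgmeas).trans
        ((ENNReal.rpow_le_rpow hgint (by norm_num)).trans_eq ?_)
      rw [← ENNReal.ofReal_ofNat 4, ← ENNReal.ofReal_mul (by norm_num),
        ENNReal.ofReal_rpow_of_nonneg (by positivity) (by norm_num), ← Real.sqrt_eq_rpow,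
        show (4 : ℝ) * τ ^ 2 = (2 * τ) ^ 2 by ring, Real.sqrt_sq (by positivity),
        ENNReal.ofReal_mul (by norm_num), ENNReal.ofReal_ofNat]
    -- The inner `2` is `√4` from the mean squared sketch error, the extra `τ` is the distance from
    -- the iterate to `Xstar`.
    calc _ ≤ 2 * (2 * ENNReal.ofReal τ + ENNReal.ofReal τ) := by gcongr
      _ = _ := by ring
  have hmeasX : AEStronglyMeasurable (fun ω => ‖Xhat t ω - Xstar‖) P := by
    have h : ∀ ω, ‖Xhat t ω - Xstar‖ = √(∑ i, ∑ j, (Xhat t ω i j - Xstar i j) ^ 2) := fun ω => by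
      rw [← Real.sqrt_sq (norm_nonneg (Xhat t ω - Xstar)), SketchyCGM.norm_sq_eq_sum]
      rfl
    simp_rw [h]
    refine AEMeasurable.aestronglyMeasurable (AEMeasurable.sqrt ?_)
    exact Finset.aemeasurable_fun_sum _ fun i _ => Finset.aemeasurable_fun_sum _ fun j _ =>
      ((hmeas t i j).sub_const _).pow_const 2
  have hint : Integrable (fun ω => ‖Xhat t ω - Xstar‖) P := by
    refine ⟨hmeasX, (hasFiniteIntegral_iff_ofReal
      (Filter.Eventually.of_forall fun ω => norm_nonneg _)).2 (hmain.trans_lt ?_)⟩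
    exact ENNReal.mul_lt_top ENNReal.ofNat_lt_top ENNReal.ofReal_lt_top
  refine ⟨hint, ?_⟩
  rw [ofReal_integral_eq_lintegral_ofReal hint
    (Filter.Eventually.of_forall fun ω => norm_nonneg _)]
  exact hmain.trans (by gcongr)
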